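/- **Theorem (variance bound for the multimodal case without mixing between modes).** Let $n\ge 1$, let $(E,\mathcal E)$ be a Polish space with its Borel $\sigma$-algebra, and let $\mu_0,\dots,\mu_n=\mu$ be probability measures on $E$ such that, for $0\le k\le n-1$, $\mu_{k+1}\ll\mu_k$ with a (version of the) density $g_{k,k+1}=d\mu_{k+1}/d\mu_k:E\to[0,\infty)$ that is bounded; put $\Gamma_g=\max_{0\le k\le n-1}\sup_{x\in E} g_{k,k+1}(x)$. For $1\le k\le n$ let $K_k$ be a Markov kernel on $E$ leaving $\mu_k$ invariant. Let $E=F^{(1)}\sqcup\dots\sqcup F^{(m)}$ be a measurable partition (the modes) with $\mu_k(F^{(r)})>0$ for $1\le k\le n$, $1\le r\le m$, and suppose that there is no mixing between the modes: $K_k(x,F^{(r)})=1$ for all $x\in F^{(r)}$, $1\le r\le m$, $1\le k\le n$. Let $K_{k,r}$ be the restriction of $K_k$ to $F^{(r)}$ and $\mu_{k,r}=\mu_k(\cdot\cap F^{(r)})/\mu_k(F^{(r)})$, identify $\mu_{k,r}$ with the operator $f\mapsto\mu_{k,r}(f)$ (a constant function), and set $$\gamma_K^{\mathrm{loc}}=1-\max_{1\le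 k\le n,\,1\le r\le m}\ \sup\bigl\{\|(K_{k,r}-\mu_{k,r})f\|_{L^2(\mu_{k,r})}:\ \mu_{k,r}(f^2)\le 1\bigr\},\qquad A=\max_{0\le j<k\le n,\ 1\le r\le m}\frac{\mu_k(F^{(r)})}{\mu_j(F^{(r)})}.$$ For $N\ge1$ consider the sequential Monte Carlo algorithm with $N$ particles: $\xi_0^1,\dots,\xi_0^N$ are i.i.d. with law $\mu_0$; given the particles $\xi_k^1,\dots,\xi_k^N$ at stage $k<n$, one draws $N$ i.i.d. particles, each equal to $\xi_k^i$ with probability $g_{k,k+1}(\xi_k^i)/\sum_{l} g_{k,k+1}(\xi_k^l)$ (if all these weights vanish, the particles are kept), and then moves each of them independently with the kernel $K_{k+1}$, which gives $\xi_{k+1}^1,\dots,\xi_{k+1}^N$. Let $\mu_n^N=\frac1N\sum_{i=1}^N\delta_{\xi_n^i}$. Assume that $\Gamma_g\,(1-\gamma_K^{\mathrm{loc}})^2<1$, and let $\phi:E\to\mathbb R$ be measurable with $\mu(\phi)=0$ and $\mu(|\phi|^{2+\varepsilon})<\infty$ for some $\varepsilon>0$. Then the central limit theorem $$N^{1/2}\,(\mu_n^N-\mu)(\phi)\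 \longrightarrow\ \mathcal N(0,V_n(\phi))\quad\text{in distribution as } N\to\infty$$ holds with $$V_n(\phi)=\sum_{k=0}^n\bigl\|G_{k,k+1}K_{k+1}G_{k+1,k+2}K_{k+2}\cdots G_{n-1,n}K_n\,\phi\bigr\|_{L^2(\mu_k)}^2,$$ where $G_{k,k+1}f=g_{k,k+1}f$ and $K_kf(x)=\int f(y)\,K_k(x,dy)$ (the term $k=n$ being $\|\phi\|_{L^2(\mu_n)}^2$), and $$V_n(\phi)\ \le\ \left(1+\frac{n\,A\,\Gamma_g}{1-(1-\gamma_K^{\mathrm{loc}})^2\,\Gamma_g}\right)\mathrm{Var}_{\mu}(\phi).$$ -/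

import Mathlib

open MeasureTheory ProbabilityTheory Filter Topology
open scoped NNReal ENNReal

noncomputable section

namespace SMC

variable {E : Type*} [MeasurableSpace E]

/-! ### The particle system -/

/-- Conditionally independent sampling: given `x`, the coordinates are independent and the
`i`-th one has law `κ i x`. -/
def productKernel {X : Type*} [MeasurableSpace X] {N : ℕ} (κ : Fin N → Kernel X E)
    [∀ i, IsMarkovKernel (κ i)] : Kernel X (Fin N → E) where
  toFun x := Measure.pi fun i => κ i x
  measurable' := by
    refine Measurable.measure_of_isPiSystem_of_isProbabilityMeasure
      (S := Set.pi Set.univ '' Set.pi Set.univ fun _ : Fin N => {s : Set E | MeasurableSet s})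
      generateFrom_pi.symm isPiSystem_pi ?_
    rintro _ ⟨s, hs, rfl⟩
    simp only [Measure.pi_pi]
    exact Finset.measurable_prod _ fun i _ => (κ i).measurable_coe (hs i (Set.mem_univ i))

instance {X : Type*} [MeasurableSpace X] {N : ℕ} (κ : Fin N → Kernel X E)
    [∀ i, IsMarkovKernel (κ i)] : IsMarkovKernel (productKernel κ) :=
  ⟨fun x => inferInstanceAs (IsProbabilityMeasure (Measure.pi fun i => κ i x))⟩

/-- Law of the `i`-th resampled particle given the current particles `x`: it equals `x j` with
probability `w (x j) / ∑ l, w (x l)`. If all the weights vanish, the particle is kept. -/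
def resampleKernel (N : ℕ) (w : E → ℝ≥0) (hw : Measurable w) (i : Fin N) :
    Kernel (Fin N → E) E where
  toFun x := if ∑ l, w (x l) = 0 then Measure.dirac (x i)
    else ∑ j, (w (x j) / ∑ l, w (x l)) • Measure.dirac (x j)
  measurable' := by
    have hwj : ∀ j : Fin N, Measurable fun x : Fin N → E => w (x j) :=
      fun j => hw.comp (measurable_pi_apply j)
    have hsum : Measurable fun x : Fin N → E => ∑ l, w (x l) :=
      Finset.measurable_sum _ fun l _ => hwj l
    have hd : ∀ j : Fin N, Measurable fun x : Fin N → E => Measure.dirac (x j) :=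
      fun j => Measure.measurable_dirac.comp (measurable_pi_apply j)
    refine Measurable.ite (hsum (measurableSet_singleton 0)) (hd i) ?_
    refine Measure.measurable_of_measurable_coe _ fun s hs => ?_
    simp only [Measure.coe_finsetSum, Finset.sum_apply, Measure.smul_apply]
    refine Finset.measurable_sum _ fun j _ => ?_
    exact ((hwj j).div hsum).smul ((Measure.measurable_coe hs).comp (hd j))

instance (N : ℕ) (w : E → ℝ≥0) (hw : Measurable w) (i : Fin N) :
    IsMarkovKernel (resampleKernel N w hw i) := by
  refine ⟨fun x => ⟨?_⟩⟩
  change (if ∑ l, w (x l) = 0 then Measure.dirac (x i)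
    else ∑ j, (w (x j) / ∑ l, w (x l)) • Measure.dirac (x j) : Measure E) Set.univ = 1
  split_ifs with h
  · simp
  · simp only [Measure.coe_finsetSum, Finset.sum_apply, Measure.smul_apply, measure_univ]
    simp only [ENNReal.smul_def, smul_eq_mul, mul_one]
    rw [← ENNReal.ofNNReal_finsetSum, ← Finset.sum_div, div_self h, ENNReal.coe_one]

/-- Law of the `N` particles at stage `k` of the sequential Monte Carlo algorithm: start from `N`
independent samples from `μ₀`; to pass from stage `k` to stage `k + 1`, first resample (`N`
independent multinomial draws with weights `g k`), then move each particle independently with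
the Markov kernel `K (k + 1)`. -/
def particleLaw (μ₀ : Measure E) (g : ℕ → E → ℝ≥0) (hg : ∀ k, Measurable (g k))
    (K : ℕ → Kernel E E) [∀ k, IsMarkovKernel (K k)] (N : ℕ) : ℕ → Measure (Fin N → E)
  | 0 => Measure.pi fun _ => μ₀
  | k + 1 =>
      ((particleLaw μ₀ g hg K N k).bind (productKernel fun i => resampleKernel N (g k) (hg k) i)).bind
        (productKernel fun i : Fin N => (K (k + 1)).comap (fun x => x i) (measurable_pi_apply i))

instance (μ₀ : Measure E) [IsProbabilityMeasure μ₀] (g : ℕ → E → ℝ≥0) (hg : ∀ k, Measurable (g k))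
    (K : ℕ → Kernel E E) [∀ k, IsMarkovKernel (K k)] (N k : ℕ) :
    IsProbabilityMeasure (particleLaw μ₀ g hg K N k) := by
  induction k with
  | zero => exact inferInstanceAs (IsProbabilityMeasure (Measure.pi fun _ : Fin N => μ₀))
  | succ k ih =>
    unfold particleLaw
    infer_instance

/-- The rescaled error `N^{1/2} (μ^N - μ)(φ)`, with `μ^N` the empirical measure of the
particles `x`. -/
def scaledError (μ : Measure E) (φ : E → ℝ) (N : ℕ) (x : Fin N → E) : ℝ :=
  √(N : ℝ) * ((N : ℝ)⁻¹ * ∑ i, φ (x i) - ∫ y, φ y ∂μ)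

/-! ### The asymptotic variance -/

/-- The operator `G_{k,k+1} K_{k+1} G_{k+1,k+2} K_{k+2} ⋯ G_{k+d-1,k+d} K_{k+d}` applied to `φ`,
where `G_{j,j+1}` is multiplication by `g j` and `K_j ψ (x) = ∫ ψ(y) K_j(x, dy)`. -/
def propagate (g : ℕ → E → ℝ≥0) (K : ℕ → Kernel E E) (φ : E → ℝ) : ℕ → ℕ → E → ℝ
  | _, 0 => φ
  | k, d + 1 => fun x => g k x * ∫ y, propagate g K φ (k + 1) d y ∂(K (k + 1) x)

/-- `V_{k,n}(φ)`, the squared norm in `L²(μ_k)` of `G_{k,k+1} K_{k+1} ⋯ G_{n-1,n} K_n φ`. -/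
def stageVariance (μ : ℕ → Measure E) (g : ℕ → E → ℝ≥0) (K : ℕ → Kernel E E) (φ : E → ℝ)
    (k n : ℕ) : ℝ :=
  ∫ x, (propagate g K φ k (n - k) x) ^ 2 ∂(μ k)

/-- `V_n(φ) = ∑_{k=0}^n V_{k,n}(φ)`. -/
def asymptoticVariance (μ : ℕ → Measure E) (g : ℕ → E → ℝ≥0) (K : ℕ → Kernel E E) (φ : E → ℝ)
    (n : ℕ) : ℝ :=
  ∑ k ∈ Finset.range (n + 1), stageVariance μ g K φ k n

/-! ### The constants `Γ_g`, `γ_K^loc` and `A` -/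

/-- `Γ_g`, the maximum over `0 ≤ k ≤ n - 1` of the supremum norm of `g k`. -/
def maxDensity (g : ℕ → E → ℝ≥0) (n : ℕ) : ℝ :=
  ⨆ k : Fin n, ⨆ x : E, (g k x : ℝ)

/-- The operator norm of `κ - π` on `L²(π)`, where `π` stands for `f ↦ π(f)`. -/
def l2Deviation {X : Type*} [MeasurableSpace X] (κ : Kernel X X) (π : Measure X) : ℝ :=
  sSup {c | ∃ f : X → ℝ, Measurable f ∧ eLpNorm f 2 π ≤ 1 ∧
    c = (eLpNorm (fun x => ∫ y, f y ∂(κ x) - ∫ y, f y ∂π) 2 π).toReal}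

/-- The restriction of a kernel to a measurable subset `S`, as a kernel on `S`. -/
def modeKernel (κ : Kernel E E) {S : Set E} (hS : MeasurableSet S) : Kernel S S :=
  (κ.comap (Subtype.val : S → E) measurable_subtype_coe).comapRight
    (MeasurableEmbedding.subtype_coe hS)

/-- The normalised restriction `B ↦ ν(B) / ν(S)` of `ν` to `S`, as a measure on `S`. -/
def modeMeasure (ν : Measure E) (S : Set E) : Measure S :=
  (ν[|S]).comap (Subtype.val : S → E)

/-- `γ_K^loc = 1 - max ‖K_{k,r} - μ_{k,r}‖`, with operator norms on `L²(μ_{k,r})` and the maximum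
over the stages `1 ≤ k ≤ n` and the modes `r`. -/
def localGap (μ : ℕ → Measure E) (K : ℕ → Kernel E E) {m : ℕ} (F : Fin m → Set E)
    (hF : ∀ r, MeasurableSet (F r)) (n : ℕ) : ℝ :=
  1 - ⨆ k : Fin n, ⨆ r : Fin m,
    l2Deviation (modeKernel (K (k + 1)) (hF r)) (modeMeasure (μ (k + 1)) (F r))

/-- `A`, the maximum of `μ_k(F r) / μ_j(F r)` over `0 ≤ j < k ≤ n` and the modes `r`. -/
def growthWithinMode (μ : ℕ → Measure E) {m : ℕ} (F : Fin m → Set E) (n : ℕ) : ℝ :=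
  sSup {a | ∃ (j k : ℕ) (r : Fin m), j < k ∧ k ≤ n ∧ a = (μ k).real (F r) / (μ j).real (F r)}

end SMC

end

/-! The limit theorem is proved by induction on the stage, for all test functions at once. The
induction hypothesis `ObeysLimitTheorems` combines a law of large numbers on `L¹`, a central limit
theorem for centred functions in `L²`, and avoidance of null sets. Given the particles `p`, with
high probability the next ones are i.i.d. with law `mixture w K p`, and the mean of `f` under this
law is the ratio of the empirical means of `w · Kf` and `w`. The conditional characteristic function
is an `N`-th power, asymptotically a phase carrying the conditional mean times a Gaussian factor of
variance `μ'(f²)`. Since the mean weight tends to `1`, the phase is governed by the previous central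
limit theorem applied to `w · Kf`. The variances add (`CondIID.clt`, `ObeysLimitTheorems.stepLaw`),
and unrolling the recursion gives `asymptoticVariance`. The `L¹` law of large numbers supplies the
uniform integrability that controls the Taylor remainders.

For the variance bound let `q_k` be the propagated test function, `v = μ_n(φ²)` and `ρ = (1 - γ)²`,
with `γ` the local gap. One density factor changes the measure and the other is at most `Γ`, so
`‖q_k‖² ≤ Γ ‖K q_{k+1}‖²`. Within a mode, `K` contracts the deviation from the mode mean but leaves
the mean alone. Without mixing, the integral of `q_k` over a mode equals that of `φ`
(`setIntegral_propagate`), so Cauchy–Schwarz bounds the contribution of the means by `A v`. The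
recursion `‖q_k‖² ≤ Γ (ρ ‖q_{k+1}‖² + A v)` stays below its fixed point `A Γ v / (1 - ρ Γ)`. -/

namespace SMC

/-! ### Convergence in probability as convergence along a filter -/

section InProbability

variable {Ω : ℕ → Type*} [∀ N, MeasurableSpace (Ω N)]

/-- The filter of sets whose complement has `P N`-probability tending to `0`; convergence in
probability along `P` is convergence along this filter. -/
def inProb (P : ∀ N, Measure (Ω N)) : Filter (Σ N, Ω N) where
  sets := {S | Tendsto (fun N => P N {x | (⟨N, x⟩ : Σ N, Ω N) ∉ S}) atTop (𝓝 0)}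
  univ_sets := by simp
  sets_of_superset {S T} hS hST := by
    refine tendsto_of_tendsto_of_tendsto_of_le_of_le tendsto_const_nhds hS (fun _ => zero_le)
      fun N => measure_mono fun x hx hxS => hx (hST hxS)
  inter_sets {S T} hS hT := by
    have h := Tendsto.add (Set.mem_ofPred.1 hS) (Set.mem_ofPred.1 hT)
    rw [add_zero] at h
    refine tendsto_of_tendsto_of_tendsto_of_le_of_le tendsto_const_nhds h (fun _ => zero_le)
      fun N => (measure_mono fun x hx => ?_).trans (measure_union_le _ _)
    by_contra hc
    simp only [Set.mem_union, Set.mem_ofPred_eq, not_or, not_not] at hc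
    exact hx hc

variable {P : ∀ N, Measure (Ω N)}

lemma mem_inProb {S : Set (Σ N, Ω N)} :
    S ∈ inProb P ↔ Tendsto (fun N => P N {x | (⟨N, x⟩ : Σ N, Ω N) ∉ S}) atTop (𝓝 0) := Iff.rfl

lemma eventually_inProb {p : (Σ N, Ω N) → Prop} :
    (∀ᶠ q in inProb P, p q) ↔ Tendsto (fun N => P N {x | ¬ p ⟨N, x⟩}) atTop (𝓝 0) := Iff.rfl

lemma tendsto_fst_inProb : Tendsto Sigma.fst (inProb P) atTop := by
  refine tendsto_atTop.2 fun b => eventually_inProb.2 ?_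
  refine tendsto_const_nhds.congr' ?_
  filter_upwards [eventually_ge_atTop b] with N hN
  simp [hN]

variable [∀ N, IsProbabilityMeasure (P N)]

/-- Bounded convergence in probability. -/
lemma tendsto_integral_of_tendsto_inProb {F : (Σ N, Ω N) → ℂ} (C : ℝ)
    (hF : ∀ N, Measurable fun x => F ⟨N, x⟩) (hC : ∀ p, ‖F p‖ ≤ C)
    (h : Tendsto F (inProb P) (𝓝 0)) :
    Tendsto (fun N => ∫ x, F ⟨N, x⟩ ∂(P N)) atTop (𝓝 0) := by
  rw [Metric.tendsto_atTop]
  intro ε hε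
  have hS : ∀ᶠ p in inProb P, ‖F p‖ < ε / 2 := by
    simpa using h.norm.eventually_lt_const (show ‖(0 : ℂ)‖ < ε / 2 by simpa using half_pos hε)
  have h1 := (ENNReal.tendsto_toReal ENNReal.zero_ne_top).comp (eventually_inProb.1 hS)
  have h2 : Tendsto (fun N => C * (P N).real {x | ¬ ‖F ⟨N, x⟩‖ < ε / 2}) atTop (𝓝 0) := by
    have h := h1.const_mul C
    rw [ENNReal.toReal_zero, mul_zero] at h
    exact h
  obtain ⟨N₀, hN₀⟩ := eventually_atTop.1 (h2.eventually_lt_const (half_pos hε))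
  refine ⟨N₀, fun N hN => ?_⟩
  have hms : MeasurableSet {x | ¬ ‖F ⟨N, x⟩‖ < ε / 2} :=
    (measurableSet_lt (hF N).norm measurable_const).compl
  have hle : ∀ x, ‖F ⟨N, x⟩‖ ≤ ε / 2 + {x | ¬ ‖F ⟨N, x⟩‖ < ε / 2}.indicator (fun _ => C) x := by
    intro x
    by_cases hx : ‖F ⟨N, x⟩‖ < ε / 2
    · rw [Set.indicator_of_notMem (by simpa using hx)]; linarith
    · rw [Set.indicator_of_mem (by simpa using hx)]; linarith [hC ⟨N, x⟩]
  have hi : Integrable (fun x => {x | ¬ ‖F ⟨N, x⟩‖ < ε / 2}.indicator (fun _ => C) x) (P N) :=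
    (integrable_const C).indicator hms
  rw [dist_zero_right]
  calc ‖∫ x, F ⟨N, x⟩ ∂(P N)‖ ≤ ∫ x, ‖F ⟨N, x⟩‖ ∂(P N) := norm_integral_le_integral_norm _
    _ ≤ ∫ x, (ε / 2 + {x | ¬ ‖F ⟨N, x⟩‖ < ε / 2}.indicator (fun _ => C) x) ∂(P N) := by
        refine integral_mono ?_ ((integrable_const _).add hi) hle
        exact (Integrable.of_bound (hF N).aestronglyMeasurable C (ae_of_all _ fun x => hC _)).norm
    _ = ε / 2 + C * (P N).real {x | ¬ ‖F ⟨N, x⟩‖ < ε / 2} := by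
        rw [integral_add (integrable_const _) hi, integral_indicator_const _ hms]
        simp [mul_comm]
    _ < ε := by linarith [hN₀ N hN]

/-- Convergence of the characteristic functions to that of a Dirac mass implies convergence in
probability. -/
lemma tendsto_inProb_of_charFun {X : (Σ N, Ω N) → ℝ} (hX : ∀ N, Measurable fun x => X ⟨N, x⟩)
    (c : ℝ) (h : ∀ t : ℝ, Tendsto (fun N => ∫ x, Complex.exp (t * X ⟨N, x⟩ * Complex.I) ∂(P N))
      atTop (𝓝 (Complex.exp (t * c * Complex.I)))) :
    Tendsto X (inProb P) (𝓝 c) := by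
  have hlim : Tendsto (β := ProbabilityMeasure ℝ)
      (fun N => ⟨(P N).map (fun x => X ⟨N, x⟩),
        Measure.isProbabilityMeasure_map (hX N).aemeasurable⟩) atTop
      (𝓝 ⟨Measure.dirac c, inferInstance⟩) := by
    refine ProbabilityMeasure.tendsto_iff_tendsto_charFun.2 fun t => ?_
    simp only [ProbabilityMeasure.coe_mk, charFun_apply_real, integral_dirac]
    refine (h t).congr fun N => ?_
    rw [integral_map (hX N).aemeasurable (by fun_prop)]
  intro U hU
  obtain ⟨V, hVU, hV, hcV⟩ := mem_nhds_iff.1 hU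
  change X ⁻¹' U ∈ inProb P
  refine mem_of_superset (x := X ⁻¹' V) ?_ (Set.preimage_mono hVU)
  rw [mem_inProb]
  -- Portmanteau for the closed set `Vᶜ`, which the Dirac mass at `c` does not charge.
  have hcl := ProbabilityMeasure.limsup_measure_closed_le_of_tendsto hlim hV.isClosed_compl
  simp only [ProbabilityMeasure.coe_mk] at hcl
  rw [Measure.dirac_apply' _ hV.isClosed_compl.measurableSet,
    Set.indicator_of_notMem (by simpa using hcV)] at hcl
  have hcl' : Tendsto (fun N => (P N).map (fun x => X ⟨N, x⟩) Vᶜ) atTop (𝓝 0) :=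
    tendsto_of_le_liminf_of_limsup_le zero_le hcl
  refine hcl'.congr fun N => ?_
  rw [Measure.map_apply (hX N) hV.isClosed_compl.measurableSet]
  rfl

/-- If the characteristic functions of `X` converge, then `X` is bounded in probability, so that
`X * Y` tends to `0` in probability when `Y` does. -/
lemma tendsto_mul_inProb_of_charFun {X Y : (Σ N, Ω N) → ℝ}
    (hX : ∀ N, Measurable fun x => X ⟨N, x⟩) {f : ℝ → ℂ} (hf : ContinuousAt f 0)
    (h : ∀ t : ℝ, Tendsto (fun N => ∫ x, Complex.exp (t * X ⟨N, x⟩ * Complex.I) ∂(P N))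
      atTop (𝓝 (f t)))
    (hY : Tendsto Y (inProb P) (𝓝 0)) :
    Tendsto (fun p => X p * Y p) (inProb P) (𝓝 0) := by
  have : ∀ N, IsProbabilityMeasure ((P N).map (fun x => X ⟨N, x⟩)) := fun N =>
    Measure.isProbabilityMeasure_map (hX N).aemeasurable
  have ht : IsTightMeasureSet (Set.range fun N => (P N).map (fun x => X ⟨N, x⟩)) := by
    refine isTightMeasureSet_of_tendsto_charFun hf fun t => ?_
    simp only [charFun_apply_real]
    refine (h t).congr fun N => ?_
    rw [integral_map (hX N).aemeasurable (by fun_prop)]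
  rw [isTightMeasureSet_iff_exists_isCompact_measure_compl_le] at ht
  rw [Metric.tendsto_nhds]
  intro ε hε
  rw [eventually_inProb, ENNReal.tendsto_nhds_zero]
  intro δ hδ
  obtain ⟨K, hK, hKP⟩ := ht (δ / 2) (ENNReal.half_pos hδ.ne')
  obtain ⟨M, hM⟩ := hK.isBounded.exists_norm_le
  -- `M` bounds the norm on `K` but may be zero, or even negative if `K` is empty; `|M| + 1` is a
  -- safe divisor.
  have hM1 : 0 < |M| + 1 := by positivity
  have hYe := eventually_inProb.1 (Metric.tendsto_nhds.1 hY (ε / (|M| + 1)) (by positivity))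
  filter_upwards [(ENNReal.tendsto_nhds_zero.1 hYe) (δ / 2) (ENNReal.half_pos hδ.ne')] with N hN
  have hKN := hKP _ ⟨N, rfl⟩
  simp only at hKN
  rw [Measure.map_apply (hX N) hK.isClosed.measurableSet.compl] at hKN
  calc P N {x | ¬ dist (X ⟨N, x⟩ * Y ⟨N, x⟩) 0 < ε}
      ≤ P N (((fun x => X ⟨N, x⟩) ⁻¹' Kᶜ) ∪ {x | ¬ dist (Y ⟨N, x⟩) 0 < ε / (|M| + 1)}) := by
        refine measure_mono fun x hx => ?_
        by_contra hc
        simp only [Set.mem_union, Set.mem_preimage, Set.mem_compl_iff, Set.mem_ofPred_eq, not_or,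
          not_not, dist_zero_right, Real.norm_eq_abs] at hc
        apply hx
        rw [dist_zero_right, norm_mul]
        have h1 := hM _ hc.1
        have h2 : |Y ⟨N, x⟩| * (|M| + 1) < ε := (lt_div_iff₀ hM1).1 hc.2
        simp only [Real.norm_eq_abs] at h1 ⊢
        nlinarith [abs_nonneg (Y ⟨N, x⟩), le_abs_self M]
    _ ≤ δ / 2 + δ / 2 := (measure_union_le _ _).trans (add_le_add hKN hN)
    _ = δ := ENNReal.add_halves δ

end InProbability

/-! ### Taylor bounds for characteristic functions -/

section ExpBounds

lemma norm_cexp_mul_I (x : ℝ) : ‖Complex.exp (x * Complex.I)‖ = 1 :=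
  Complex.norm_exp_ofReal_mul_I x

lemma norm_cexp_sub_one_le (x : ℝ) : ‖Complex.exp (x * Complex.I) - 1‖ ≤ |x| := by
  rw [mul_comm]; exact Real.norm_exp_I_mul_ofReal_sub_one_le

/-- Taylor's formula for small `x` and the triangle inequality for large `x`. The factor `min 1 |x|`
keeps the growth linear, so the remainder is integrable for `f` merely in `L¹`; the quadratic
version plays the same role in `L²`. -/
lemma norm_cexp_sub_linear_le (x : ℝ) :
    ‖Complex.exp (x * Complex.I) - 1 - x * Complex.I‖ ≤ 2 * |x| * min 1 |x| := by
  have hn : ‖(x : ℂ) * Complex.I‖ = |x| := by simp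
  rcases le_total |x| 1 with h | h
  · rw [min_eq_right h]
    have := Complex.norm_exp_sub_one_sub_id_le (x := x * Complex.I) (by rwa [hn])
    rw [hn] at this
    nlinarith [abs_nonneg x]
  · rw [min_eq_left h]
    refine (norm_sub_le _ _).trans ?_
    rw [hn]
    linarith [norm_cexp_sub_one_le x]

lemma norm_cexp_sub_quadratic_le (x : ℝ) :
    ‖Complex.exp (x * Complex.I) - 1 - x * Complex.I + x ^ 2 / 2‖ ≤ 3 * x ^ 2 * min 1 |x| := by
  have hn : ‖(x : ℂ) * Complex.I‖ = |x| := by simp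
  rcases le_total |x| 1 with h | h
  · rw [min_eq_right h]
    have hb := Complex.exp_bound (x := x * Complex.I) (by rwa [hn]) (n := 3) (by norm_num)
    rw [hn] at hb
    have he : Complex.exp (x * Complex.I) - 1 - x * Complex.I + x ^ 2 / 2 =
        Complex.exp (x * Complex.I) -
          ∑ m ∈ Finset.range 3, ((x : ℂ) * Complex.I) ^ m / m.factorial := by
      simp [Finset.sum_range_succ, mul_pow, Nat.factorial]; ring
    rw [he]
    refine hb.trans ?_
    have : x ^ 2 * |x| = |x| ^ 3 := by rw [← sq_abs]; ring
    rw [mul_assoc, this, mul_comm]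
    refine mul_le_mul_of_nonneg_right ?_ (by positivity)
    norm_num [Nat.factorial]
  · rw [min_eq_left h]
    have h1 : ‖(x : ℂ) ^ 2 / 2‖ = |x| ^ 2 / 2 := by simp
    refine (norm_add_le _ _).trans ?_
    rw [h1]
    have h2 := norm_sub_le (Complex.exp (x * Complex.I) - 1) (x * Complex.I)
    rw [hn] at h2
    nlinarith [norm_cexp_sub_one_le x, sq_abs x]

/-- Reduces the comparison of `n`-th powers to a one-particle estimate of order `o(1/n)`. -/
lemma norm_pow_sub_pow_le {u v : ℂ} (hu : ‖u‖ ≤ 1) (hv : ‖v‖ ≤ 1) (n : ℕ) :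
    ‖u ^ n - v ^ n‖ ≤ n * ‖u - v‖ := by
  induction n with
  | zero => simp
  | succ n ih =>
    have h : u ^ (n + 1) - v ^ (n + 1) = u ^ n * (u - v) + (u ^ n - v ^ n) * v := by ring
    rw [h]
    refine (norm_add_le _ _).trans ?_
    rw [norm_mul, norm_mul, norm_pow]
    have h1 : ‖u‖ ^ n ≤ 1 := pow_le_one₀ (norm_nonneg _) hu
    push_cast
    nlinarith [norm_nonneg (u - v), norm_nonneg (u ^ n - v ^ n)]

end ExpBounds

/-! ### Limit theorems for samples from random measures -/

section RandomMeasures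

variable {E ι : Type*} [MeasurableSpace E]

/-- The (random) measures `π p` are eventually probability measures and `π p f` tends to `μ f`
along `l` for all `μ`-integrable `f`. -/
structure Approximates (l : Filter ι) (π : ι → Measure E) (μ : Measure E) : Prop where
  isProb : ∀ᶠ p in l, IsProbabilityMeasure (π p)
  integrable : ∀ f : E → ℝ, Measurable f → Integrable f μ → ∀ᶠ p in l, Integrable f (π p)
  tendsto : ∀ f : E → ℝ, Measurable f → Integrable f μ →
    Tendsto (fun p => ∫ x, f x ∂(π p)) l (𝓝 (∫ x, f x ∂μ))

variable {l : Filter ι} {π : ι → Measure E} {μ : Measure E}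

lemma Approximates.const [IsProbabilityMeasure μ] : Approximates l (fun _ => μ) μ where
  isProb := .of_forall fun _ => inferInstance
  integrable _ _ hf := .of_forall fun _ => hf
  tendsto _ _ _ := tendsto_const_nhds

lemma integrable_mul_min {u v : E → ℝ} (hu : Measurable u) (hv : Measurable v)
    (hv0 : ∀ x, 0 ≤ v x) (hui : Integrable u μ) {a : ℝ} (ha : 0 ≤ a) :
    Integrable (fun x => u x * min 1 (a * v x)) μ := by
  refine hui.mono (by fun_prop : Measurable _).aestronglyMeasurable (ae_of_all _ fun x => ?_)
  have h : 0 ≤ min 1 (a * v x) := le_min zero_le_one (mul_nonneg ha (hv0 x))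
  rw [norm_mul, Real.norm_of_nonneg h]
  exact mul_le_of_le_one_right (norm_nonneg _) (min_le_left _ _)

/-- Uniform integrability along an approximating family of measures. -/
lemma Approximates.tendsto_mul_min (h : Approximates l π μ) {u v : E → ℝ} (hu : Measurable u)
    (hv : Measurable v) (hu0 : ∀ x, 0 ≤ u x) (hv0 : ∀ x, 0 ≤ v x) (hui : Integrable u μ)
    {a : ι → ℝ} (ha0 : ∀ p, 0 ≤ a p) (ha : Tendsto a l (𝓝 0)) :
    Tendsto (fun p => ∫ x, u x * min 1 (a p * v x) ∂(π p)) l (𝓝 0) := by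
  have hmin : ∀ b : ℝ, 0 ≤ b → ∀ x, 0 ≤ min 1 (b * v x) :=
    fun b hb x => le_min zero_le_one (mul_nonneg hb (hv0 x))
  have hint : ∀ b : ℝ, 0 ≤ b → Integrable (fun x => u x * min 1 (b * v x)) μ :=
    fun b hb => integrable_mul_min hu hv hv0 hui hb
  -- Once `a p` is below a fixed `1 / (M + 1)`, the integrand is dominated by a function independent
  -- of `p`, to which the convergence of `π p` applies; dominated convergence makes its `μ`-integral
  -- small for large `M`.
  have hlim : Tendsto (fun M : ℕ => ∫ x, u x * min 1 (1 / ((M : ℝ) + 1) * v x) ∂μ) atTop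
      (𝓝 0) := by
    have h0 : (0 : ℝ) = ∫ x, u x * min 1 (0 * v x) ∂μ := by simp
    rw [h0]
    refine tendsto_integral_of_dominated_convergence u
      (fun M => (hint _ (by positivity)).aestronglyMeasurable) hui (fun M => ae_of_all _ fun x => ?_)
      (ae_of_all _ fun x => ?_)
    · rw [Real.norm_of_nonneg (mul_nonneg (hu0 x) (hmin _ (by positivity) x))]
      exact mul_le_of_le_one_right (hu0 x) (min_le_left _ _)
    · exact (tendsto_const_nhds.min (tendsto_one_div_add_atTop_nhds_zero_nat.mul_const _)).const_mul _
  rw [Metric.tendsto_nhds]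
  intro ε hε
  obtain ⟨M, hM⟩ := (hlim.eventually_lt_const hε).exists
  have hpos : 0 < 1 / ((M : ℝ) + 1) := by positivity
  have hMm : Measurable fun x => u x * min 1 (1 / ((M : ℝ) + 1) * v x) := by fun_prop
  filter_upwards [(h.tendsto _ hMm (hint _ hpos.le)).eventually_lt_const hM,
    h.integrable _ hMm (hint _ hpos.le), ha.eventually_lt_const hpos, h.integrable _ hu hui]
    with p hp hpi hap hup
  have hnn : 0 ≤ ∫ x, u x * min 1 (a p * v x) ∂(π p) :=
    integral_nonneg fun x => mul_nonneg (hu0 x) (hmin _ (ha0 p) x)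
  rw [Real.dist_eq, sub_zero, abs_of_nonneg hnn]
  refine lt_of_le_of_lt (integral_mono (integrable_mul_min hu hv hv0 hup (ha0 p)) hpi fun x => ?_) hp
  exact mul_le_mul_of_nonneg_left
    (min_le_min le_rfl (mul_le_mul_of_nonneg_right hap.le (hv0 x))) (hu0 x)

lemma norm_integral_cexp_le [IsProbabilityMeasure μ] (f : E → ℝ) :
    ‖∫ x, Complex.exp (f x * Complex.I) ∂μ‖ ≤ 1 := by
  have := norm_integral_le_of_norm_le_const (μ := μ)
    (ae_of_all _ fun x => (norm_cexp_mul_I (f x)).le)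
  simpa using this

lemma integrable_cexp [IsFiniteMeasure μ] {f : E → ℝ} (hf : Measurable f) :
    Integrable (fun x => Complex.exp (f x * Complex.I)) μ :=
  Integrable.of_bound (by fun_prop : Measurable _).aestronglyMeasurable 1
    (ae_of_all _ fun x => (norm_cexp_mul_I (f x)).le)

lemma norm_integral_cexp_sub_linear_le [IsProbabilityMeasure μ] {f : E → ℝ} (hf : Measurable f)
    (hfi : Integrable f μ) :
    ‖∫ x, Complex.exp (f x * Complex.I) ∂μ - 1 - (∫ x, f x ∂μ : ℝ) * Complex.I‖ ≤
      ∫ x, 2 * |f x| * min 1 |f x| ∂μ := by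
  have h : ∫ x, Complex.exp (f x * Complex.I) ∂μ - 1 - (∫ x, f x ∂μ : ℝ) * Complex.I =
      ∫ x, (Complex.exp (f x * Complex.I) - 1 - f x * Complex.I) ∂μ := by
    have h1 : Integrable (fun x => Complex.exp (f x * Complex.I) - 1) μ :=
      (integrable_cexp hf).sub (integrable_const _)
    have h2 : Integrable (fun x => (f x : ℂ) * Complex.I) μ := hfi.ofReal.mul_const _
    rw [integral_sub h1 h2, integral_sub (integrable_cexp hf) (integrable_const _),
      integral_mul_const, integral_complex_ofReal]
    simp
  rw [h]
  refine norm_integral_le_of_norm_le ?_ (ae_of_all _ fun x => norm_cexp_sub_linear_le (f x))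
  simpa using integrable_mul_min (a := 1) (by fun_prop : Measurable fun x => 2 * |f x|)
    (by fun_prop : Measurable fun x => |f x|) (fun x => abs_nonneg _) (hfi.abs.const_mul 2)
    zero_le_one

lemma norm_integral_cexp_sub_quadratic_le [IsProbabilityMeasure μ] {f : E → ℝ} (hf : Measurable f)
    (hfi : Integrable f μ) (hfi2 : Integrable (fun x => f x ^ 2) μ) :
    ‖∫ x, Complex.exp (f x * Complex.I) ∂μ - 1 - (∫ x, f x ∂μ : ℝ) * Complex.I
      + (∫ x, f x ^ 2 ∂μ : ℝ) / 2‖ ≤ ∫ x, 3 * f x ^ 2 * min 1 |f x| ∂μ := by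
  have h : ∫ x, Complex.exp (f x * Complex.I) ∂μ - 1 - (∫ x, f x ∂μ : ℝ) * Complex.I
      + (∫ x, f x ^ 2 ∂μ : ℝ) / 2 =
      ∫ x, (Complex.exp (f x * Complex.I) - 1 - f x * Complex.I + (f x) ^ 2 / 2) ∂μ := by
    have h2 : Integrable (fun x => (f x : ℂ) ^ 2 / 2) μ := by
      simpa using (hfi2.ofReal (𝕜 := ℂ)).div_const 2
    have h1 : Integrable (fun x => Complex.exp (f x * Complex.I) - 1) μ :=
      (integrable_cexp hf).sub (integrable_const _)
    have h3 : Integrable (fun x => (f x : ℂ) * Complex.I) μ := hfi.ofReal.mul_const _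
    have h4 : Integrable (fun x => Complex.exp (f x * Complex.I) - 1 - f x * Complex.I) μ :=
      h1.sub h3
    rw [integral_add h4 h2, integral_sub h1 h3,
      integral_sub (integrable_cexp hf) (integrable_const _), integral_mul_const,
      integral_complex_ofReal, integral_div, ← integral_complex_ofReal (f := fun x => f x ^ 2)]
    simp
  rw [h]
  refine norm_integral_le_of_norm_le ?_ (ae_of_all _ fun x => norm_cexp_sub_quadratic_le (f x))
  simpa using integrable_mul_min (a := 1) (by fun_prop : Measurable fun x => 3 * f x ^ 2)
    (by fun_prop : Measurable fun x => |f x|) (fun x => abs_nonneg _) (hfi2.const_mul 3)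
    zero_le_one

variable {size : ι → ℕ}

/-- Law of large numbers for conditionally independent samples, in terms of characteristic
functions. -/
lemma Approximates.tendsto_charFun_mean (h : Approximates l π μ) (hs : Tendsto size l atTop)
    {f : E → ℝ} (hf : Measurable f) (hfi : Integrable f μ) (t : ℝ) :
    Tendsto (fun p => (∫ x, Complex.exp ((t * ((size p : ℝ)⁻¹ * f x) : ℝ) * Complex.I) ∂(π p))
      ^ size p) l (𝓝 (Complex.exp ((t * ∫ x, f x ∂μ : ℝ) * Complex.I))) := by
  have hinv : Tendsto (fun p => (size p : ℝ)⁻¹) l (𝓝 0) :=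
    tendsto_inv_atTop_zero.comp (tendsto_natCast_atTop_atTop.comp hs)
  have hT := h.tendsto f hf hfi
  have hlim : Tendsto (fun p => Complex.exp ((t * ∫ x, f x ∂(π p) : ℝ) * Complex.I)) l
      (𝓝 (Complex.exp ((t * ∫ x, f x ∂μ : ℝ) * Complex.I))) := by
    have hc : Continuous fun y : ℝ => Complex.exp ((t * y : ℝ) * Complex.I) := by fun_prop
    exact (hc.tendsto _).comp hT
  refine tendsto_of_tendsto_of_dist hlim ?_
  have hA := h.tendsto_mul_min (u := fun x => |t * f x|) (v := fun x => |t * f x|) (by fun_prop)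
    (by fun_prop) (fun _ => abs_nonneg _) (fun _ => abs_nonneg _) (hfi.const_mul t).abs
    (fun p => inv_nonneg.2 (Nat.cast_nonneg (size p))) hinv
  have hB : Tendsto (fun p => 2 * ∫ x, |t * f x| * min 1 ((size p : ℝ)⁻¹ * |t * f x|) ∂(π p)
      + 2 * (t * ∫ x, f x ∂(π p)) ^ 2 * (size p : ℝ)⁻¹) l (𝓝 0) := by
    simpa using (hA.const_mul 2).add ((((hT.const_mul t).pow 2).const_mul 2).mul hinv)
  refine squeeze_zero' (.of_forall fun _ => dist_nonneg) ?_ hB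
  filter_upwards [h.isProb, h.integrable f hf hfi, hs.eventually_ge_atTop 1] with p hp hfp hn
  set n := size p
  set a := (n : ℝ)⁻¹
  have hn0 : (0 : ℝ) < n := by exact_mod_cast hn
  have ha0 : 0 < a := inv_pos.2 hn0
  have hna : n * a = 1 := mul_inv_cancel₀ hn0.ne'
  set m := ∫ x, f x ∂(π p)
  have hv : Complex.exp ((t * m : ℝ) * Complex.I) =
      Complex.exp ((t * (a * m) : ℝ) * Complex.I) ^ n := by
    rw [← Complex.exp_nat_mul]
    congr 1
    have : ((n : ℂ) * (a : ℂ)) = 1 := by exact_mod_cast hna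
    push_cast
    linear_combination (-(t : ℂ) * m * Complex.I) * this
  have hm : ∫ x, t * (a * f x) ∂(π p) = t * (a * m) := by
    rw [integral_const_mul, integral_const_mul]
  have h1 := norm_integral_cexp_sub_linear_le (μ := π p) (f := fun x => t * (a * f x))
    (by fun_prop) ((hfp.const_mul a).const_mul t)
  rw [hm] at h1
  have h2 := norm_cexp_sub_linear_le (t * (a * m))
  have habs : ∀ y : ℝ, |t * (a * y)| = a * |t * y| := fun y => by
    rw [mul_left_comm, abs_mul, abs_of_pos ha0]
  simp only [habs] at h1 h2
  have h3 : ∫ x, 2 * (a * |t * f x|) * min 1 (a * |t * f x|) ∂(π p) =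
      a * (2 * ∫ x, |t * f x| * min 1 (a * |t * f x|) ∂(π p)) := by
    rw [← integral_const_mul, ← integral_const_mul]
    congr 1; ext x; ring
  have h4 : 2 * (a * |t * m|) * min 1 (a * |t * m|) ≤ a * (2 * (t * m) ^ 2 * a) := by
    calc 2 * (a * |t * m|) * min 1 (a * |t * m|) ≤ 2 * (a * |t * m|) * (a * |t * m|) :=
          mul_le_mul_of_nonneg_left (min_le_right _ _) (by positivity)
      _ = a * (2 * |t * m| ^ 2 * a) := by ring
      _ = _ := by rw [sq_abs]
  rw [h3] at h1
  rw [hv, dist_comm, dist_eq_norm]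
  refine (norm_pow_sub_pow_le (norm_integral_cexp_le _) (norm_cexp_mul_I _).le n).trans ?_
  have h5 := dist_triangle_right (∫ x, Complex.exp ((t * (a * f x) : ℝ) * Complex.I) ∂(π p))
    (Complex.exp ((t * (a * m) : ℝ) * Complex.I)) (1 + (t * (a * m) : ℝ) * Complex.I)
  simp only [dist_eq_norm, ← sub_sub] at h5
  calc (n : ℝ) * _ ≤ n * (a * (2 * ∫ x, |t * f x| * min 1 (a * |t * f x|) ∂(π p)) +
        a * (2 * (t * m) ^ 2 * a)) :=
        mul_le_mul_of_nonneg_left (h5.trans (add_le_add h1 (h2.trans h4))) hn0.le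
    _ = (n * a) * (2 * ∫ x, |t * f x| * min 1 (a * |t * f x|) ∂(π p) +
        2 * (t * m) ^ 2 * a) := by ring
    _ = _ := by rw [hna, one_mul]

/-- Central limit theorem for conditionally independent samples, in terms of characteristic
functions. -/
lemma Approximates.tendsto_charFun_sum (h : Approximates l π μ) (hs : Tendsto size l atTop)
    {f : E → ℝ} (hf : Measurable f) (hfi : Integrable f μ) (hfi2 : Integrable (fun x => f x ^ 2) μ)
    (hf0 : ∫ x, f x ∂μ = 0) (t : ℝ) :
    Tendsto (fun p => (∫ x, Complex.exp ((t * ((√(size p : ℝ))⁻¹ * f x) : ℝ) * Complex.I) ∂(π p))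
        ^ size p - Complex.exp ((t * (√(size p : ℝ) * ∫ x, f x ∂(π p)) : ℝ) * Complex.I) *
          Complex.exp (-(t ^ 2 * ∫ x, f x ^ 2 ∂μ) / 2 : ℝ)) l (𝓝 0) := by
  have hinv : Tendsto (fun p => (√(size p : ℝ))⁻¹) l (𝓝 0) :=
    tendsto_inv_atTop_zero.comp
      (Real.tendsto_sqrt_atTop.comp (tendsto_natCast_atTop_atTop.comp hs))
  have hT := h.tendsto f hf hfi
  have hT2 := h.tendsto _ (hf.pow_const 2) hfi2
  rw [hf0] at hT
  set s := ∫ x, f x ^ 2 ∂μ with hs_def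
  have hs0 : 0 ≤ s := integral_nonneg fun x => sq_nonneg _
  have hA := h.tendsto_mul_min (u := fun x => 3 * (t * f x) ^ 2) (v := fun x => |t * f x|)
    (by fun_prop) (by fun_prop) (fun _ => by positivity) (fun _ => abs_nonneg _)
    (by simpa only [mul_pow] using (hfi2.const_mul (t ^ 2)).const_mul 3)
    (fun p => inv_nonneg.2 (Real.sqrt_nonneg (size p))) hinv
  -- `W p` is the squared norm of the exponent `w` introduced below; `W p ≤ 1` allows the quadratic
  -- Taylor bound for `exp w`.
  set W : ι → ℝ := fun p => (t * ((√(size p : ℝ))⁻¹ * ∫ x, f x ∂(π p))) ^ 2 +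
    ((√(size p : ℝ))⁻¹ ^ 2 * (t ^ 2 * s / 2)) ^ 2 with hW
  have hWlim : Tendsto W l (𝓝 0) := by
    simpa [hW] using (((hinv.mul hT).const_mul t).pow 2).add
      (((hinv.pow 2).mul_const (t ^ 2 * s / 2)).pow 2)
  have hB : Tendsto (fun p =>
      ∫ x, 3 * (t * f x) ^ 2 * min 1 ((√(size p : ℝ))⁻¹ * |t * f x|) ∂(π p)
      + t ^ 2 / 2 * |∫ x, f x ^ 2 ∂(π p) - s| + ((t * ∫ x, f x ∂(π p)) ^ 2 +
        (√(size p : ℝ))⁻¹ ^ 2 * (t ^ 2 * s / 2) ^ 2)) l (𝓝 0) := by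
    have h1 := ((hT2.sub_const s).abs.const_mul (t ^ 2 / 2))
    rw [sub_self] at h1
    simpa using (hA.add h1).add
      (((hT.const_mul t).pow 2).add ((hinv.pow 2).mul_const ((t ^ 2 * s / 2) ^ 2)))
  refine squeeze_zero_norm' ?_ hB
  filter_upwards [h.isProb, h.integrable f hf hfi, h.integrable _ (hf.pow_const 2) hfi2,
    hs.eventually_ge_atTop 1, hWlim.eventually_le_const zero_lt_one] with p hp hfp hfp2 hn hW1
  set n := size p
  set a := (√(n : ℝ))⁻¹
  have hn0 : (0 : ℝ) < n := by exact_mod_cast hn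
  have ha0 : 0 < a := inv_pos.2 (Real.sqrt_pos.2 hn0)
  have hna : n * a = √(n : ℝ) := by
    rw [← div_eq_mul_inv, Real.div_sqrt]
  have hna2 : n * a ^ 2 = 1 := by
    rw [inv_pow, Real.sq_sqrt hn0.le, mul_inv_cancel₀ hn0.ne']
  set m := ∫ x, f x ∂(π p)
  set q := ∫ x, f x ^ 2 ∂(π p)
  -- The one-particle share of the limiting exponent. The drift `√n m` stays in the phase exactly,
  -- so it need not be bounded; only `m → 0` is used.
  set w : ℂ := (t * (a * m) : ℝ) * Complex.I - (a ^ 2 * (t ^ 2 * s / 2) : ℝ) with hw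
  have hwn : ‖w‖ ^ 2 = (t * (a * m)) ^ 2 + (a ^ 2 * (t ^ 2 * s / 2)) ^ 2 := by
    rw [← Complex.normSq_eq_norm_sq, Complex.normSq_apply, hw]
    simp only [Complex.sub_re, Complex.sub_im, Complex.re_ofReal_mul, Complex.im_ofReal_mul,
      Complex.I_re, Complex.I_im, Complex.ofReal_re, Complex.ofReal_im]
    ring
  have hw1 : ‖w‖ ≤ 1 := by
    exact (sq_le_one_iff₀ (norm_nonneg _)).1 (hwn.trans_le hW1)
  have hv : Complex.exp ((t * (√(n : ℝ) * m) : ℝ) * Complex.I) *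
      Complex.exp (-(t ^ 2 * s) / 2 : ℝ) = Complex.exp w ^ n := by
    rw [← Complex.exp_nat_mul, ← Complex.exp_add, ← hna]
    congr 1
    have : ((n : ℂ) * (a : ℂ) ^ 2) = 1 := by exact_mod_cast hna2
    rw [hw]
    push_cast
    linear_combination ((t : ℂ) ^ 2 * s / 2) * this
  have hv1 : ‖Complex.exp w‖ ≤ 1 := by
    rw [Complex.norm_exp, Real.exp_le_one_iff, hw]
    simp only [Complex.sub_re, Complex.re_ofReal_mul, Complex.I_re, Complex.ofReal_re]
    have : 0 ≤ a ^ 2 * (t ^ 2 * s / 2) := by positivity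
    linarith
  have hm : ∫ x, t * (a * f x) ∂(π p) = t * (a * m) := by
    rw [integral_const_mul, integral_const_mul]
  have hq : ∫ x, (t * (a * f x)) ^ 2 ∂(π p) = a ^ 2 * (t ^ 2 * q) := by
    rw [← integral_const_mul, ← integral_const_mul]
    congr 1; ext x; ring
  have h1 := norm_integral_cexp_sub_quadratic_le (μ := π p) (f := fun x => t * (a * f x))
    (by fun_prop) ((hfp.const_mul a).const_mul t)
    (by simpa only [mul_pow] using (hfp2.const_mul (a ^ 2)).const_mul (t ^ 2))
  rw [hm, hq] at h1
  have h3 : ∫ x, 3 * (t * (a * f x)) ^ 2 * min 1 |t * (a * f x)| ∂(π p) =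
      a ^ 2 * ∫ x, 3 * (t * f x) ^ 2 * min 1 (a * |t * f x|) ∂(π p) := by
    rw [← integral_const_mul]
    congr 1; ext x
    rw [mul_left_comm t a, abs_mul, abs_of_pos ha0]; ring
  rw [h3] at h1
  have h2 := Complex.norm_exp_sub_one_sub_id_le hw1
  rw [hwn] at h2
  rw [hv]
  refine (norm_pow_sub_pow_le (norm_integral_cexp_le _) hv1 n).trans ?_
  set u := ∫ x, Complex.exp ((t * (a * f x) : ℝ) * Complex.I) ∂(π p)
  have h4 : ‖((a ^ 2 * (t ^ 2 / 2 * (q - s)) : ℝ) : ℂ)‖ = a ^ 2 * (t ^ 2 / 2 * |q - s|) := by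
    rw [Complex.norm_real, Real.norm_eq_abs, abs_mul, abs_mul, abs_of_nonneg (sq_nonneg a),
      abs_of_nonneg (by positivity : 0 ≤ t ^ 2 / 2)]
  -- Three errors: the Taylor remainder of `u`, the gap between the second moments under `π p` and
  -- `μ`, and the Taylor remainder of `exp w`. Multiplied by `n`, each vanishes because `n a² = 1`.
  have h5 : u - Complex.exp w = (u - 1 - (t * (a * m) : ℝ) * Complex.I +
      (a ^ 2 * (t ^ 2 * q) : ℝ) / 2) - (a ^ 2 * (t ^ 2 / 2 * (q - s)) : ℝ) -
      (Complex.exp w - 1 - w) := by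
    rw [hw]; push_cast; ring
  have h6 : ‖u - Complex.exp w‖ ≤
      a ^ 2 * ∫ x, 3 * (t * f x) ^ 2 * min 1 (a * |t * f x|) ∂(π p) +
      a ^ 2 * (t ^ 2 / 2 * |q - s|) + ((t * (a * m)) ^ 2 + (a ^ 2 * (t ^ 2 * s / 2)) ^ 2) := by
    rw [h5]
    refine (norm_sub_le _ _).trans (add_le_add ((norm_sub_le _ _).trans ?_) h2)
    rw [h4]
    exact add_le_add h1 le_rfl
  calc (n : ℝ) * _ ≤ _ := mul_le_mul_of_nonneg_left h6 hn0.le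
    _ = (n * a ^ 2) * (∫ x, 3 * (t * f x) ^ 2 * min 1 (a * |t * f x|) ∂(π p)
      + t ^ 2 / 2 * |q - s| + ((t * m) ^ 2 + a ^ 2 * (t ^ 2 * s / 2) ^ 2)) := by ring
    _ = _ := by rw [hna2, one_mul]

end RandomMeasures

variable {E : Type*} [MeasurableSpace E]

/-! ### Conditionally independent particles -/

section ConditionallyIID

/-- The mean of `f` under the empirical measure of the particles `x`. -/
noncomputable def empMean (f : E → ℝ) (p : Σ N, Fin N → E) : ℝ :=
  (p.1 : ℝ)⁻¹ * ∑ i, f (p.2 i)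

lemma measurable_empMean {f : E → ℝ} (hf : Measurable f) (N : ℕ) :
    Measurable fun x : Fin N → E => empMean f ⟨N, x⟩ := by
  have h : Measurable fun x : Fin N → E => (N : ℝ)⁻¹ * ∑ i, f (x i) :=
    (Finset.measurable_sum Finset.univ fun i _ =>
      hf.comp (g := f) (measurable_pi_apply i)).const_mul _
  exact h

lemma measurableSet_forall_notMem {B : Set E} (hB : MeasurableSet B) (N : ℕ) :
    MeasurableSet {y : Fin N → E | ∀ i, y i ∉ B} := by
  have h : {y : Fin N → E | ∀ i, y i ∉ B} = ⋂ i, (fun y => y i) ⁻¹' Bᶜ := by ext; simp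
  rw [h]
  exact MeasurableSet.iInter fun i => measurable_pi_apply i hB.compl

lemma prod_cexp_eq {X : Type*} (f : X → ℝ) (t a : ℝ) {N : ℕ} (x : Fin N → X) :
    ∏ i, Complex.exp ((t * (a * f (x i)) : ℝ) * Complex.I) =
      Complex.exp ((t * (a * ∑ i, f (x i)) : ℝ) * Complex.I) := by
  rw [← Complex.exp_sum, ← Finset.sum_mul, ← Complex.ofReal_sum, ← Finset.mul_sum,
    ← Finset.mul_sum]

/-- The laws `P N` of `N` particles satisfy a law of large numbers with limit `μ` and a central
limit theorem with asymptotic variance `V`. -/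
structure ObeysLimitTheorems (P : ∀ N, Measure (Fin N → E)) (μ : Measure E)
    (V : (E → ℝ) → ℝ) : Prop where
  avoids : ∀ B, MeasurableSet B → μ B = 0 → ∀ᶠ p in inProb P, ∀ i, p.2 i ∉ B
  lln : ∀ f : E → ℝ, Measurable f → Integrable f μ →
    Tendsto (empMean f) (inProb P) (𝓝 (∫ x, f x ∂μ))
  clt : ∀ f : E → ℝ, Measurable f → Integrable (fun x => f x ^ 2) μ → ∫ x, f x ∂μ = 0 →
    ∀ t : ℝ, Tendsto (fun N : ℕ => ∫ x : Fin N → E,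
      Complex.exp ((t * (√(N : ℝ) * empMean f ⟨N, x⟩) : ℝ) * Complex.I) ∂(P N)) atTop
      (𝓝 (Complex.exp (-(t ^ 2 * V f) / 2 : ℝ)))

variable {Ω : ℕ → Type*} [∀ N, MeasurableSpace (Ω N)]

/-- Conditionally on the past, described by `P`, and up to events of vanishing probability, the
particles with law `Q N` are independent with law `π`, and `π` approximates `μ`. -/
structure CondIID (P : ∀ N, Measure (Ω N)) (Q : ∀ N, Measure (Fin N → E))
    (π : (Σ N, Ω N) → Measure E) (μ : Measure E) : Prop where
  approx : Approximates (inProb P) π μ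
  null : ∀ B, MeasurableSet B → μ B = 0 → ∀ᶠ p in inProb P, π p B = 0
  integral_prod : ∀ h : ℕ → E → ℂ, (∀ N, Measurable (h N)) → (∀ N x, ‖h N x‖ ≤ 1) →
    ∃ J : (Σ N, Ω N) → ℂ, (∀ N, Measurable fun x => J ⟨N, x⟩) ∧ (∀ p, ‖J p‖ ≤ 1) ∧
      (∀ᶠ p in inProb P, J p = (∫ y, h p.1 y ∂(π p)) ^ p.1) ∧
      ∀ N, ∫ y, ∏ i, h N (y i) ∂(Q N) = ∫ x, J ⟨N, x⟩ ∂(P N)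

namespace CondIID

variable {P : ∀ N, Measure (Ω N)} {Q : ∀ N, Measure (Fin N → E)} {π : (Σ N, Ω N) → Measure E}
  {μ : Measure E} [∀ N, IsProbabilityMeasure (P N)]

/-- `J` equals the `N`-th power only with high probability, but `J` and `F` are bounded by `1`
everywhere, so the exceptional events disappear in the limit. -/
lemma tendsto_integral_prod_sub (hc : CondIID P Q π μ) {h : ℕ → E → ℂ}
    (hm : ∀ N, Measurable (h N)) (hb : ∀ N x, ‖h N x‖ ≤ 1) {F : (Σ N, Ω N) → ℂ}
    (hF : ∀ N, Measurable fun x => F ⟨N, x⟩) (hF1 : ∀ p, ‖F p‖ ≤ 1)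
    (hlim : Tendsto (fun p => (∫ y, h p.1 y ∂(π p)) ^ p.1 - F p) (inProb P) (𝓝 0)) :
    Tendsto (fun N => ∫ y, ∏ i, h N (y i) ∂(Q N) - ∫ x, F ⟨N, x⟩ ∂(P N)) atTop (𝓝 0) := by
  obtain ⟨J, hJ, hJ1, hJe, hJi⟩ := hc.integral_prod h hm hb
  have hlim' : Tendsto (fun p => J p - F p) (inProb P) (𝓝 0) := by
    refine hlim.congr' ?_
    filter_upwards [hJe] with p hp
    rw [hp]
  refine (tendsto_integral_of_tendsto_inProb 2 (fun N => (hJ N).sub (hF N)) (fun p => ?_)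
    hlim').congr fun N => ?_
  · exact (norm_sub_le _ _).trans (by linarith [hJ1 p, hF1 p])
  · rw [hJi, integral_sub
      (Integrable.of_bound (hJ N).aestronglyMeasurable 1 (ae_of_all _ fun x => hJ1 _))
      (Integrable.of_bound (hF N).aestronglyMeasurable 1 (ae_of_all _ fun x => hF1 _))]

/-- The conditional fluctuation contributes a deterministic Gaussian factor and the conditional mean
a random phase, replaced by that of `S`. The limit is a product of two Gaussian factors, so the
variances add. -/
lemma clt (hc : CondIID P Q π μ) {f : E → ℝ} (hf : Measurable f) (hfi : Integrable f μ)
    (hfi2 : Integrable (fun x => f x ^ 2) μ) (hf0 : ∫ x, f x ∂μ = 0) {S : (Σ N, Ω N) → ℝ}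
    (hS : ∀ N, Measurable fun x => S ⟨N, x⟩) (t v : ℝ)
    (hπS : Tendsto (fun p => √(p.1 : ℝ) * ∫ x, f x ∂(π p) - S p) (inProb P) (𝓝 0))
    (hSlim : Tendsto (fun N => ∫ x, Complex.exp ((t * S ⟨N, x⟩ : ℝ) * Complex.I) ∂(P N)) atTop
      (𝓝 (Complex.exp (-(t ^ 2 * v) / 2 : ℝ)))) :
    Tendsto (fun N : ℕ => ∫ x : Fin N → E,
      Complex.exp ((t * (√(N : ℝ) * empMean f ⟨N, x⟩) : ℝ) * Complex.I) ∂(Q N)) atTop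
      (𝓝 (Complex.exp (-(t ^ 2 * (∫ x, f x ^ 2 ∂μ + v)) / 2 : ℝ))) := by
  have hlim := hc.approx.tendsto_charFun_sum tendsto_fst_inProb hf hfi hfi2 hf0 t
  set s := ∫ x, f x ^ 2 ∂μ with hs
  have hs0 : 0 ≤ s := integral_nonneg fun x => sq_nonneg _
  have hdiff : Tendsto (fun p : Σ N, Ω N =>
      Complex.exp ((t * (√(p.1 : ℝ) * ∫ x, f x ∂(π p)) : ℝ) * Complex.I) -
        Complex.exp ((t * S p : ℝ) * Complex.I)) (inProb P) (𝓝 0) := by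
    have h0 : Tendsto (fun p => |t * (√(p.1 : ℝ) * ∫ x, f x ∂(π p) - S p)|) (inProb P) (𝓝 0) := by
      simpa using (hπS.const_mul t).abs
    refine squeeze_zero_norm (fun p => ?_) h0
    have he : Complex.exp ((t * (√(p.1 : ℝ) * ∫ x, f x ∂(π p)) : ℝ) * Complex.I) -
        Complex.exp ((t * S p : ℝ) * Complex.I) = Complex.exp ((t * S p : ℝ) * Complex.I) *
        (Complex.exp ((t * (√(p.1 : ℝ) * ∫ x, f x ∂(π p) - S p) : ℝ) * Complex.I) - 1) := by
      rw [mul_sub, ← Complex.exp_add, mul_one]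
      congr 2
      push_cast; ring
    rw [he, norm_mul, norm_cexp_mul_I, one_mul]
    exact norm_cexp_sub_one_le _
  have h := hc.tendsto_integral_prod_sub
    (h := fun N y => Complex.exp ((t * ((√(N : ℝ))⁻¹ * f y) : ℝ) * Complex.I))
    (F := fun p => Complex.exp ((t * S p : ℝ) * Complex.I) * Complex.exp (-(t ^ 2 * s) / 2 : ℝ))
    (fun N => by fun_prop) (fun N x => (norm_cexp_mul_I _).le)
    (fun N => (Complex.measurable_exp.comp
      ((Complex.measurable_ofReal.comp ((hS N).const_mul t)).mul_const _)).mul_const _)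
    (fun p => ?_) ?_
  · simp only [prod_cexp_eq, integral_mul_const] at h
    have h2 := h.add (hSlim.mul_const (Complex.exp (-(t ^ 2 * s) / 2 : ℝ)))
    have hv : (0 : ℂ) + Complex.exp (-(t ^ 2 * v) / 2 : ℝ) * Complex.exp (-(t ^ 2 * s) / 2 : ℝ) =
        Complex.exp (-(t ^ 2 * (s + v)) / 2 : ℝ) := by
      rw [zero_add, ← Complex.exp_add]
      congr 1
      push_cast; ring
    rw [hv] at h2
    refine h2.congr fun N => ?_
    rw [sub_add_cancel]
    congr 1; ext x
    have hN : √(N : ℝ) * (N : ℝ)⁻¹ = (√(N : ℝ))⁻¹ := by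
      rw [← div_eq_mul_inv, Real.sqrt_div_self]
    rw [empMean, ← mul_assoc (√(N : ℝ)), hN]
  · rw [norm_mul, norm_cexp_mul_I, one_mul, Complex.norm_exp, Complex.ofReal_re,
      Real.exp_le_one_iff]
    have : 0 ≤ t ^ 2 * s := by positivity
    linarith
  · have h3 := hlim.add (hdiff.mul_const (Complex.exp (-(t ^ 2 * s) / 2 : ℝ)))
    rw [zero_mul, add_zero] at h3
    refine h3.congr fun p => ?_
    ring

variable [∀ N, IsProbabilityMeasure (Q N)]

/-- For the indicator of `Bᶜ` the product over the particles indicates that all of them avoid `B`.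
It matters that `π p B` is exactly zero: `π p B → 0` would not control an `N`-th power. -/
lemma avoids (hc : CondIID P Q π μ) {B : Set E} (hB : MeasurableSet B) (hμB : μ B = 0) :
    ∀ᶠ p in inProb Q, ∀ i, p.2 i ∉ B := by
  classical
  have h := hc.tendsto_integral_prod_sub (h := fun _ => Bᶜ.indicator fun _ => (1 : ℂ))
    (F := fun _ => 1) (fun _ => measurable_const.indicator hB.compl)
    (fun _ x => by by_cases hx : x ∈ B <;> simp [hx]) (fun _ => measurable_const)
    (fun _ => by simp) ?_
  · rw [eventually_inProb]
    have hprod : ∀ N : ℕ, ∫ y : Fin N → E, ∏ i, Bᶜ.indicator (fun _ => (1 : ℂ)) (y i) ∂(Q N) =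
        ((Q N).real {y | ∀ i, y i ∉ B} : ℝ) := by
      intro N
      have hms := measurableSet_forall_notMem hB N
      rw [← integral_indicator_one hms, ← integral_complex_ofReal]
      congr 1; ext y
      by_cases hy : ∀ i, y i ∉ B
      · simp [hy]
      · obtain ⟨i, hi⟩ := not_forall.1 hy
        rw [Finset.prod_eq_zero (Finset.mem_univ i) (by simpa using hi)]
        simp only [Set.indicator, Set.mem_ofPred_eq, hy, if_false, Complex.ofReal_zero]
    simp only [hprod, integral_const, probReal_univ, one_smul] at h
    have h' := h.norm
    rw [norm_zero] at h'
    have hreal : Tendsto (fun N => (Q N).real {y | ¬ ∀ i, y i ∉ B}) atTop (𝓝 0) := by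
      refine h'.congr fun N => ?_
      have hms := measurableSet_forall_notMem hB N
      have hcompl := probReal_compl_eq_one_sub (μ := Q N) hms
      rw [← Complex.ofReal_one, ← Complex.ofReal_sub, Complex.norm_real, norm_sub_rev, ← hcompl,
        Real.norm_of_nonneg measureReal_nonneg]
      rfl
    exact (ENNReal.tendsto_toReal_iff (fun N => measure_ne_top _ _) ENNReal.zero_ne_top).1 hreal
  · refine tendsto_const_nhds.congr' ?_
    filter_upwards [hc.approx.isProb, hc.null B hB hμB] with p hp hpB
    rw [integral_indicator_const _ hB.compl, probReal_compl_eq_one_sub hB, measureReal_def, hpB]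
    simp

lemma lln (hc : CondIID P Q π μ) {f : E → ℝ} (hf : Measurable f) (hfi : Integrable f μ) :
    Tendsto (empMean f) (inProb Q) (𝓝 (∫ x, f x ∂μ)) := by
  refine tendsto_inProb_of_charFun (fun N => measurable_empMean hf N) _ fun t => ?_
  have hlim := hc.approx.tendsto_charFun_mean tendsto_fst_inProb hf hfi t
  have h := hc.tendsto_integral_prod_sub
    (h := fun N y => Complex.exp ((t * ((N : ℝ)⁻¹ * f y) : ℝ) * Complex.I))
    (F := fun _ => Complex.exp ((t * ∫ x, f x ∂μ : ℝ) * Complex.I)) (fun N => by fun_prop)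
    (fun N x => (norm_cexp_mul_I _).le) (fun N => measurable_const)
    (fun p => (norm_cexp_mul_I _).le) (tendsto_sub_nhds_zero_iff.2 hlim)
  simp only [prod_cexp_eq, integral_const, probReal_univ, one_smul] at h
  simpa [empMean] using h.add_const (Complex.exp ((t * ∫ x, f x ∂μ : ℝ) * Complex.I))

end CondIID

end ConditionallyIID

/-! ### Invariant kernels, densities and Cauchy–Schwarz -/

lemma integral_bind_kernel {X Y F : Type*} [MeasurableSpace X] [MeasurableSpace Y]
    [NormedAddCommGroup F] [NormedSpace ℝ F] {ν : Measure X} {κ : Kernel X Y} {f : Y → F}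
    (hf : Integrable f (ν.bind κ)) : ∫ y, f y ∂(ν.bind κ) = ∫ x, ∫ y, f y ∂(κ x) ∂ν := by
  rw [Measure.comp_eq_comp_const_apply] at hf ⊢
  rw [Kernel.integral_comp hf, Kernel.const_apply]

/-- Cauchy–Schwarz against the constant `1`, with the total mass kept: applied to a mode, this mass
becomes the numerator of a ratio in `growthWithinMode`. -/
lemma sq_integral_le_measureReal_mul {X : Type*} [MeasurableSpace X] {ν : Measure X}
    [IsFiniteMeasure ν] {f : X → ℝ} (hf : Integrable f ν)
    (hf2 : Integrable (fun x => f x ^ 2) ν) :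
    (∫ x, f x ∂ν) ^ 2 ≤ ν.real Set.univ * ∫ x, f x ^ 2 ∂ν := by
  rcases eq_or_lt_of_le (measureReal_nonneg : 0 ≤ ν.real Set.univ) with h0 | h0
  · have : ν = 0 := by simpa [measureReal_def, ENNReal.toReal_eq_zero_iff] using h0.symm
    simp [this]
  set c := ν.real Set.univ
  set I := ∫ x, f x ∂ν with hI
  have h : 0 ≤ ∫ x, (c * f x ^ 2 - 2 * I * f x + I ^ 2 / c) ∂ν :=
    integral_nonneg fun x => by
      have h1 : c * f x ^ 2 - 2 * I * f x + I ^ 2 / c = (c * f x - I) ^ 2 / c := by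
        field_simp; ring
      simp only [Pi.zero_apply]
      rw [h1]
      positivity
  have h1 : Integrable (fun x => c * f x ^ 2 - 2 * I * f x) ν :=
    (hf2.const_mul _).sub (hf.const_mul _)
  rw [integral_add h1 (integrable_const _), integral_sub (hf2.const_mul _) (hf.const_mul _),
    integral_const_mul, integral_const_mul, integral_const, smul_eq_mul, ← hI,
    mul_div_cancel₀ _ h0.ne'] at h
  linarith

lemma sq_integral_le {X : Type*} [MeasurableSpace X] {ν : Measure X} [IsProbabilityMeasure ν]
    {f : X → ℝ} (hf : Integrable f ν) (hf2 : Integrable (fun x => f x ^ 2) ν) :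
    (∫ x, f x ∂ν) ^ 2 ≤ ∫ x, f x ^ 2 ∂ν := by
  simpa using sq_integral_le_measureReal_mul hf hf2

lemma integrable_of_integrable_sq {X : Type*} [MeasurableSpace X] {ν : Measure X}
    [IsFiniteMeasure ν] {f : X → ℝ} (hf : AEStronglyMeasurable f ν)
    (hf2 : Integrable (fun x => f x ^ 2) ν) : Integrable f ν :=
  ((memLp_two_iff_integrable_sq hf).2 hf2).integrable one_le_two

section Invariant

variable {X : Type*} [MeasurableSpace X] {ν : Measure X} {K : Kernel X X} {f : X → ℝ}

lemma ae_ae_of_invariant (hK : Kernel.Invariant K ν) {p : X → Prop} (hp : ∀ᵐ x ∂ν, p x) :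
    ∀ᵐ x ∂ν, ∀ᵐ y ∂(K x), p y := by
  rw [← hK.def] at hp
  exact Measure.ae_ae_of_ae_comp hp

lemma ae_integrable_of_invariant (hK : Kernel.Invariant K ν) (hf : Integrable f ν) :
    ∀ᵐ x ∂ν, Integrable f (K x) := by
  rw [← hK.def] at hf
  exact Measure.ae_integrable_of_integrable_comp hf

lemma integrable_integral_of_invariant (hK : Kernel.Invariant K ν) (hf : Integrable f ν) :
    Integrable (fun x => ∫ y, f y ∂(K x)) ν := by
  rw [← hK.def, Measure.comp_eq_comp_const_apply] at hf
  simpa using hf.integral_comp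

lemma integral_integral_of_invariant (hK : Kernel.Invariant K ν) (hf : Integrable f ν) :
    ∫ x, ∫ y, f y ∂(K x) ∂ν = ∫ x, f x ∂ν := by
  conv_rhs => rw [← hK.def]
  rw [integral_bind_kernel (by rwa [hK.def])]

variable [IsMarkovKernel K]

lemma ae_sq_integral_le_of_invariant (hK : Kernel.Invariant K ν) (hf : Measurable f)
    (hf2 : Integrable (fun x => f x ^ 2) ν) :
    ∀ᵐ x ∂ν, (∫ y, f y ∂(K x)) ^ 2 ≤ ∫ y, f y ^ 2 ∂(K x) := by
  filter_upwards [ae_integrable_of_invariant hK hf2] with x hx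
  exact sq_integral_le (integrable_of_integrable_sq hf.aestronglyMeasurable hx) hx

lemma integrable_sq_integral_of_invariant (hK : Kernel.Invariant K ν) (hf : Measurable f)
    (hf2 : Integrable (fun x => f x ^ 2) ν) :
    Integrable (fun x => (∫ y, f y ∂(K x)) ^ 2) ν := by
  refine (integrable_integral_of_invariant hK hf2).mono'
    (hf.stronglyMeasurable.integral_kernel.measurable.pow_const 2).aestronglyMeasurable ?_
  filter_upwards [ae_sq_integral_le_of_invariant hK hf hf2] with x hx
  rwa [Real.norm_of_nonneg (sq_nonneg _)]

lemma integral_sq_integral_le_of_invariant (hK : Kernel.Invariant K ν) (hf : Measurable f)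
    (hf2 : Integrable (fun x => f x ^ 2) ν) :
    ∫ x, (∫ y, f y ∂(K x)) ^ 2 ∂ν ≤ ∫ x, f x ^ 2 ∂ν := by
  rw [← integral_integral_of_invariant hK hf2]
  exact integral_mono_ae (integrable_sq_integral_of_invariant hK hf hf2)
    (integrable_integral_of_invariant hK hf2) (ae_sq_integral_le_of_invariant hK hf hf2)

end Invariant

/-- One factor `w` is kept to change the measure; the other is bounded by `C`. -/
lemma mul_sq_le_of_density {X : Type*} {w : X → ℝ≥0} {f : X → ℝ} {C : ℝ} (hC : ∀ x, (w x : ℝ) ≤ C)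
    (x : X) :
    ((w x : ℝ) * f x) ^ 2 ≤ C * (w x * f x ^ 2) := by
  rw [mul_pow, sq (w x : ℝ), mul_assoc]
  exact mul_le_mul_of_nonneg_right (hC x) (by positivity)

section Density

variable {μ μ' : Measure E} {w : E → ℝ≥0}

lemma integrable_mul_of_density (hw : Measurable w)
    (hμ : μ' = μ.withDensity fun x => (w x : ℝ≥0∞)) {f : E → ℝ} :
    Integrable (fun x => (w x : ℝ) * f x) μ ↔ Integrable f μ' := by
  rw [hμ, integrable_withDensity_iff_integrable_smul hw]
  rfl

lemma integral_mul_of_density (hw : Measurable w)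
    (hμ : μ' = μ.withDensity fun x => (w x : ℝ≥0∞)) (f : E → ℝ) :
    ∫ x, (w x : ℝ) * f x ∂μ = ∫ x, f x ∂μ' := by
  rw [hμ, integral_withDensity_eq_integral_smul hw]
  rfl

/-- Nothing is known where `w` vanishes, which is harmless: such particles have weight zero in
`mixture`. -/
lemma ae_of_density (hw : Measurable w) (hμ : μ' = μ.withDensity fun x => (w x : ℝ≥0∞))
    {p : E → Prop} (hp : ∀ᵐ x ∂μ', p x) : ∀ᵐ x ∂μ, w x ≠ 0 → p x := by
  rw [hμ, ae_withDensity_iff (by fun_prop)] at hp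
  simpa using hp

variable {C : ℝ} {f : E → ℝ}

lemma integrable_sq_mul_of_density (hw : Measurable w)
    (hμ : μ' = μ.withDensity fun x => (w x : ℝ≥0∞)) (hC : ∀ x, (w x : ℝ) ≤ C) (hf : Measurable f)
    (hf2 : Integrable (fun x => f x ^ 2) μ') :
    Integrable (fun x => ((w x : ℝ) * f x) ^ 2) μ := by
  refine (((integrable_mul_of_density hw hμ).2 hf2).const_mul C).mono'
    (by fun_prop : Measurable _).aestronglyMeasurable (ae_of_all _ fun x => ?_)
  rw [Real.norm_of_nonneg (sq_nonneg _)]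
  exact mul_sq_le_of_density hC x

lemma integral_sq_mul_le_of_density (hw : Measurable w)
    (hμ : μ' = μ.withDensity fun x => (w x : ℝ≥0∞)) (hC : ∀ x, (w x : ℝ) ≤ C) (hf : Measurable f)
    (hf2 : Integrable (fun x => f x ^ 2) μ') :
    ∫ x, ((w x : ℝ) * f x) ^ 2 ∂μ ≤ C * ∫ x, f x ^ 2 ∂μ' := by
  rw [← integral_mul_of_density hw hμ, ← integral_const_mul]
  exact integral_mono (integrable_sq_mul_of_density hw hμ hC hf hf2)
    (((integrable_mul_of_density hw hμ).2 hf2).const_mul C) (mul_sq_le_of_density hC)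

end Density

/-! ### One stage of the algorithm -/

section Step

/-- The law of a particle drawn from the weighted empirical measure of `p` and moved with `K`. -/
noncomputable def mixture (w : E → ℝ≥0) (K : Kernel E E) (p : Σ N, Fin N → E) : Measure E :=
  ∑ j, (w (p.2 j) / ∑ l, w (p.2 l)) • K (p.2 j)

/-- One stage of the algorithm: resample, then move. -/
noncomputable def stepLaw {N : ℕ} (P : Measure (Fin N → E)) (w : E → ℝ≥0) (hw : Measurable w)
    (K : Kernel E E) [IsMarkovKernel K] : Measure (Fin N → E) :=
  (P.bind (productKernel fun i => resampleKernel N w hw i)).bind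
    (productKernel fun i : Fin N => K.comap (fun x => x i) (measurable_pi_apply i))

instance {N : ℕ} (P : Measure (Fin N → E)) [IsProbabilityMeasure P] (w : E → ℝ≥0)
    (hw : Measurable w) (K : Kernel E E) [IsMarkovKernel K] :
    IsProbabilityMeasure (stepLaw P w hw K) := by
  unfold stepLaw
  infer_instance

variable {w : E → ℝ≥0} {K : Kernel E E}

lemma isProbabilityMeasure_mixture [IsMarkovKernel K] {p : Σ N, Fin N → E}
    (hp : ∑ l, w (p.2 l) ≠ 0) :
    IsProbabilityMeasure (mixture w K p) := by
  refine ⟨?_⟩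
  simp only [mixture, Measure.coe_finsetSum, Finset.sum_apply, Measure.smul_apply, measure_univ]
  simp only [ENNReal.smul_def, smul_eq_mul, mul_one]
  rw [← ENNReal.ofNNReal_finsetSum, ← Finset.sum_div, div_self hp, ENNReal.coe_one]

lemma mixture_apply_eq_zero {p : Σ N, Fin N → E} {B : Set E}
    (hp : ∀ i, w (p.2 i) ≠ 0 → K (p.2 i) B = 0) : mixture w K p B = 0 := by
  simp only [mixture, Measure.coe_finsetSum, Finset.sum_apply, Measure.smul_apply]
  refine Finset.sum_eq_zero fun i _ => ?_
  by_cases h : w (p.2 i) = 0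
  · simp [h]
  · simp [hp i h]

lemma integrable_smul_of_ne_zero {F : Type*} [NormedAddCommGroup F] {f : E → F}
    {p : Σ N, Fin N → E} (hp : ∀ i, w (p.2 i) ≠ 0 → Integrable f (K (p.2 i))) (i : Fin p.1) :
    Integrable f ((w (p.2 i) / ∑ l, w (p.2 l)) • K (p.2 i)) := by
  by_cases h : w (p.2 i) = 0
  · simp [h]
  · exact (hp i h).smul_measure_nnreal

lemma integrable_mixture {F : Type*} [NormedAddCommGroup F] {f : E → F} {p : Σ N, Fin N → E}
    (hp : ∀ i, w (p.2 i) ≠ 0 → Integrable f (K (p.2 i))) : Integrable f (mixture w K p) :=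
  integrable_finsetSum_measure.2 fun i _ => integrable_smul_of_ne_zero hp i

lemma integral_mixture {F : Type*} [NormedAddCommGroup F] [NormedSpace ℝ F] {f : E → F}
    {p : Σ N, Fin N → E} (hp : ∀ i, w (p.2 i) ≠ 0 → Integrable f (K (p.2 i))) :
    ∫ y, f y ∂(mixture w K p) =
      ∑ j, (w (p.2 j) / ∑ l, w (p.2 l)) • ∫ y, f y ∂(K (p.2 j)) := by
  rw [mixture, integral_finsetSum_measure fun i _ => integrable_smul_of_ne_zero hp i]
  simp only [integral_smul_nnreal_measure]

lemma integral_mixture_eq_div {f : E → ℝ} {p : Σ N, Fin N → E}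
    (hp : ∀ i, w (p.2 i) ≠ 0 → Integrable f (K (p.2 i))) :
    ∫ y, f y ∂(mixture w K p) =
      empMean (fun x => w x * ∫ y, f y ∂(K x)) p / empMean (fun x => (w x : ℝ)) p := by
  rw [integral_mixture hp, empMean, empMean]
  rcases Nat.eq_zero_or_pos p.1 with h0 | h0
  · have : IsEmpty (Fin p.1) := by rw [h0]; infer_instance
    simp
  · rw [mul_div_mul_left _ _ (by positivity), Finset.sum_div]
    refine Finset.sum_congr rfl fun j _ => ?_
    rw [NNReal.smul_def, smul_eq_mul]
    push_cast
    ring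

lemma integrable_of_norm_le_one {F : Type*} [NormedAddCommGroup F] {X : Type*} [MeasurableSpace X]
    {ν : Measure X} [IsFiniteMeasure ν] {f : X → F} (hf : StronglyMeasurable f)
    (h : ∀ x, ‖f x‖ ≤ 1) : Integrable f ν :=
  Integrable.of_bound hf.aestronglyMeasurable 1 (ae_of_all _ h)

lemma norm_integral_le_one {X : Type*} [MeasurableSpace X] {ν : Measure X}
    [IsProbabilityMeasure ν] {f : X → ℂ} (h : ∀ x, ‖f x‖ ≤ 1) : ‖∫ x, f x ∂ν‖ ≤ 1 := by
  simpa using norm_integral_le_of_norm_le_const (μ := ν) (ae_of_all _ h)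

lemma integral_prod_productKernel {X : Type*} [MeasurableSpace X] {N : ℕ}
    (κ : Fin N → Kernel X E) [∀ i, IsMarkovKernel (κ i)] (h : E → ℂ) (x : X) :
    ∫ y, ∏ i, h (y i) ∂(productKernel κ x) = ∏ i, ∫ y, h y ∂(κ i x) :=
  integral_fintype_prod_eq_prod (fun _ => h)

lemma integral_resampleKernel (hw : Measurable w) {N : ℕ} (i : Fin N) {x : Fin N → E}
    (hx : ∑ l, w (x l) ≠ 0) {h : E → ℂ} (hm : Measurable h) :
    ∫ y, h y ∂(resampleKernel N w hw i x) = ∑ j, (w (x j) / ∑ l, w (x l)) • h (x j) := by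
  have hR : resampleKernel N w hw i x =
      ∑ j, (w (x j) / ∑ l, w (x l)) • Measure.dirac (x j) := if_neg hx
  rw [hR, integral_finsetSum_measure]
  · simp only [integral_smul_nnreal_measure]
    exact Finset.sum_congr rfl fun j _ => by rw [integral_dirac' _ _ hm.stronglyMeasurable]
  · intro j _
    exact (integrable_dirac' hm.stronglyMeasurable (by simp)).smul_measure_nnreal

variable [IsMarkovKernel K]

/-- The expectation of a product over the particles after one stage, as an integral over the
particles before that stage. -/
lemma exists_integral_prod_stepLaw (hw : Measurable w) {h : E → ℂ} (hm : Measurable h)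
    (hb : ∀ x, ‖h x‖ ≤ 1) (N : ℕ) :
    ∃ J : (Fin N → E) → ℂ, Measurable J ∧ (∀ x, ‖J x‖ ≤ 1) ∧
      (∀ x, ∑ l, w (x l) ≠ 0 → J x = (∫ y, h y ∂(mixture w K ⟨N, x⟩)) ^ N) ∧
      ∀ P : Measure (Fin N → E), IsProbabilityMeasure P →
        ∫ y, ∏ i, h (y i) ∂(stepLaw P w hw K) = ∫ x, J x ∂P := by
  have hKm : StronglyMeasurable fun x => ∫ y, h y ∂(K x) := hm.stronglyMeasurable.integral_kernel
  have hprod : ∀ f : E → ℂ, Measurable f → StronglyMeasurable fun y : Fin N → E => ∏ i, f (y i) :=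
    fun f hf => (Finset.measurable_prod Finset.univ fun i _ =>
      hf.comp (g := f) (measurable_pi_apply i)).stronglyMeasurable
  have hprod1 : ∀ f : E → ℂ, (∀ x, ‖f x‖ ≤ 1) → ∀ y : Fin N → E, ‖∏ i, f (y i)‖ ≤ 1 :=
    fun f hf y => by
      rw [norm_prod]
      exact Finset.prod_le_one (fun i _ => norm_nonneg _) fun i _ => hf _
  have hK1 : ∀ x, ‖∫ y, h y ∂(K x)‖ ≤ 1 := fun x => norm_integral_le_one hb
  refine ⟨fun x => ∫ z, ∏ i, ∫ y, h y ∂(K (z i))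
    ∂(productKernel (fun i => resampleKernel N w hw i) x),
    ((hprod _ hKm.measurable).integral_kernel).measurable,
    fun x => norm_integral_le_one (hprod1 _ hK1), fun x hx => ?_, fun P hP => ?_⟩
  -- When the weights do not all vanish, every coordinate has the same resampling law, so the
  -- product of the integrals is an `N`-th power.
  · simp only
    rw [integral_prod_productKernel _ (fun z => ∫ y, h y ∂(K z))]
    simp only [integral_resampleKernel hw _ hx hKm.measurable, Finset.prod_const,
      Finset.card_univ, Fintype.card_fin]
    rw [integral_mixture fun i _ => integrable_of_norm_le_one hm.stronglyMeasurable hb]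
  · rw [stepLaw, integral_bind_kernel
      (integrable_of_norm_le_one (hprod h hm) (hprod1 h hb))]
    simp only [integral_prod_productKernel, Kernel.comap_apply]
    rw [integral_bind_kernel
      (integrable_of_norm_le_one (hprod _ hKm.measurable) (hprod1 _ hK1))]

variable {P : ∀ N, Measure (Fin N → E)} {μ μ' : Measure E} {V : (E → ℝ) → ℝ}

lemma ObeysLimitTheorems.eventually_forall (hP : ObeysLimitTheorems P μ V) {p : E → Prop}
    (hm : MeasurableSet {x | p x}) (hp : ∀ᵐ x ∂μ, p x) : ∀ᶠ q in inProb P, ∀ i, p (q.2 i) := by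
  filter_upwards [hP.avoids {x | p x}ᶜ hm.compl hp] with q hq i
  exact not_not.1 (hq i)

lemma measurableSet_ne_zero_imp (hw : Measurable w) {p : E → Prop}
    (hm : MeasurableSet {x | p x}) : MeasurableSet {x | w x ≠ 0 → p x} := by
  have h : {x | w x ≠ 0 → p x} = (w ⁻¹' {0}) ∪ {x | p x} := by
    ext x
    by_cases hx : w x = 0 <;> simp [hx]
  rw [h]
  exact (hw (measurableSet_singleton 0)).union hm

/-- Invariance gives integrability under `K x` only for `μ'`-almost every `x`; avoidance of null
sets transfers it to all particles of positive weight. -/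
lemma ObeysLimitTheorems.eventually_integrable (hP : ObeysLimitTheorems P μ V) (hw : Measurable w)
    (hμ : μ' = μ.withDensity fun x => (w x : ℝ≥0∞)) (hK : Kernel.Invariant K μ') {f : E → ℝ}
    (hf : Measurable f) (hfi : Integrable f μ') :
    ∀ᶠ p in inProb P, ∀ i, w (p.2 i) ≠ 0 → Integrable f (K (p.2 i)) :=
  hP.eventually_forall
    (measurableSet_ne_zero_imp hw
      (measurableSet_kernel_integrable (f := fun _ => f)
        (hf.comp measurable_snd).stronglyMeasurable))
    (ae_of_density hw hμ (ae_integrable_of_invariant hK hfi))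

variable [IsProbabilityMeasure μ']

lemma ObeysLimitTheorems.tendsto_weights (hP : ObeysLimitTheorems P μ V) (hw : Measurable w)
    (hμ : μ' = μ.withDensity fun x => (w x : ℝ≥0∞)) :
    Tendsto (empMean fun x => (w x : ℝ)) (inProb P) (𝓝 1) := by
  have hi : Integrable (fun x => (w x : ℝ)) μ := by
    simpa using (integrable_mul_of_density hw hμ).2 (integrable_const (1 : ℝ))
  have h1 : ∫ x, (w x : ℝ) ∂μ = 1 := by
    simpa using integral_mul_of_density hw hμ fun _ => (1 : ℝ)
  simpa [h1] using hP.lln _ (by fun_prop) hi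

lemma ObeysLimitTheorems.eventually_sum_ne_zero (hP : ObeysLimitTheorems P μ V)
    (hw : Measurable w) (hμ : μ' = μ.withDensity fun x => (w x : ℝ≥0∞)) :
    ∀ᶠ p in inProb P, ∑ l, w (p.2 l) ≠ 0 := by
  filter_upwards [(hP.tendsto_weights hw hμ).eventually_ne one_ne_zero] with p hp h0
  refine hp ?_
  rw [empMean, ← NNReal.coe_sum, h0]
  simp

variable [∀ N, IsProbabilityMeasure (P N)]

/-- The mixture mean of `f` is a ratio of empirical means; its numerator tends to `μ(w · Kf) =
μ'(Kf) = μ'(f)` and its denominator to `1`. -/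
lemma ObeysLimitTheorems.condIID_stepLaw (hP : ObeysLimitTheorems P μ V) (hw : Measurable w)
    (hμ : μ' = μ.withDensity fun x => (w x : ℝ≥0∞)) (hK : Kernel.Invariant K μ') :
    CondIID P (fun N => stepLaw (P N) w hw K) (mixture w K) μ' where
  approx :=
    { isProb := (hP.eventually_sum_ne_zero hw hμ).mono fun p hp => isProbabilityMeasure_mixture hp
      integrable := fun f hf hfi =>
        (hP.eventually_integrable hw hμ hK hf hfi).mono fun p hp => integrable_mixture hp
      tendsto := fun f hf hfi => by
        have hKf := integrable_integral_of_invariant hK hfi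
        have hKm := hf.stronglyMeasurable.integral_kernel (κ := K) |>.measurable
        have h := (hP.lln (fun x => w x * ∫ y, f y ∂(K x)) (by fun_prop)
          ((integrable_mul_of_density hw hμ).2 hKf)).div (hP.tendsto_weights hw hμ) one_ne_zero
        rw [div_one, integral_mul_of_density hw hμ, integral_integral_of_invariant hK hfi] at h
        refine h.congr' ?_
        filter_upwards [hP.eventually_integrable hw hμ hK hf hfi] with p hp
        rw [integral_mixture_eq_div hp, Pi.div_apply] }
  null B hB hμB := by
    have hae : ∀ᵐ x ∂μ', K x B = 0 := by
      have h1 : ∀ᵐ x ∂μ', x ∉ B := measure_eq_zero_iff_ae_notMem.1 hμB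
      filter_upwards [ae_ae_of_invariant hK h1] with x hx
      exact measure_eq_zero_iff_ae_notMem.2 hx
    refine (hP.eventually_forall (measurableSet_ne_zero_imp hw
      (K.measurable_coe hB (measurableSet_singleton 0))) (ae_of_density hw hμ hae)).mono
      fun p hp => mixture_apply_eq_zero hp
  integral_prod h hm hb := by
    choose J hJm hJ1 hJe hJi using fun N => exists_integral_prod_stepLaw (K := K) hw (hm N) (hb N) N
    refine ⟨fun p => J p.1 p.2, hJm, fun p => hJ1 _ _, ?_, fun N => hJi N (P N) inferInstance⟩
    filter_upwards [hP.eventually_sum_ne_zero hw hμ] with p hp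
    exact hJe _ _ hp

/-- The limit theorems propagate through one stage of the algorithm. -/
lemma ObeysLimitTheorems.stepLaw (hP : ObeysLimitTheorems P μ V) (hw : Measurable w) {C : ℝ}
    (hC : ∀ x, (w x : ℝ) ≤ C) (hμ : μ' = μ.withDensity fun x => (w x : ℝ≥0∞))
    (hK : Kernel.Invariant K μ') :
    ObeysLimitTheorems (fun N => SMC.stepLaw (P N) w hw K) μ'
      (fun f => ∫ x, f x ^ 2 ∂μ' + V fun x => w x * ∫ y, f y ∂(K x)) where
  avoids B hB hμB := (hP.condIID_stepLaw hw hμ hK).avoids hB hμB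
  lln f hf hfi := (hP.condIID_stepLaw hw hμ hK).lln hf hfi
  clt f hf hfi2 hf0 t := by
    have hfi := integrable_of_integrable_sq hf.aestronglyMeasurable hfi2
    have hKm := hf.stronglyMeasurable.integral_kernel (κ := K) |>.measurable
    have hgm : Measurable fun x => (w x : ℝ) * ∫ y, f y ∂(K x) := by fun_prop
    have hclt := hP.clt _ hgm (integrable_sq_mul_of_density hw hμ hC hKm
      (integrable_sq_integral_of_invariant hK hf hfi2))
      (by rw [integral_mul_of_density hw hμ, integral_integral_of_invariant hK hfi, hf0])
    set S : (Σ N, Fin N → E) → ℝ :=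
      fun p => √(p.1 : ℝ) * empMean (fun x => w x * ∫ y, f y ∂(K x)) p with hS
    have hSm : ∀ N, Measurable fun x => S ⟨N, x⟩ :=
      fun N => (measurable_empMean hgm N).const_mul (√(N : ℝ))
    refine (hP.condIID_stepLaw hw hμ hK).clt hf hfi hfi2 hf0 hSm t _ ?_ (hclt t)
    -- The difference between the rescaled mixture mean and `S` is `S` times this quantity; `S` is
    -- tight because its characteristic functions converge.
    have hY : Tendsto (fun p => (empMean (fun x => (w x : ℝ)) p)⁻¹ - 1) (inProb P) (𝓝 0) := by
      simpa using ((hP.tendsto_weights hw hμ).inv₀ one_ne_zero).sub_const 1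
    have hSY := tendsto_mul_inProb_of_charFun hSm
      (f := fun t => Complex.exp (-(t ^ 2 * V fun x => w x * ∫ y, f y ∂(K x)) / 2 : ℝ))
      (by fun_prop) (fun t => by simpa [hS] using hclt t) hY
    refine hSY.congr' ?_
    filter_upwards [hP.eventually_integrable hw hμ hK hf hfi] with p hp
    rw [integral_mixture_eq_div hp, hS]
    ring

/-- The limit theorems for independent particles. -/
lemma obeysLimitTheorems_pi [IsProbabilityMeasure μ] :
    ObeysLimitTheorems (fun N => Measure.pi fun _ : Fin N => μ) μ fun f => ∫ x, f x ^ 2 ∂μ := by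
  -- There is no past to condition on, so any probability laws can play that role; the initial laws
  -- themselves are used, with a constant `π`.
  have hc : CondIID (fun N => Measure.pi fun _ : Fin N => μ) (fun N => Measure.pi fun _ : Fin N => μ)
      (fun _ => μ) μ :=
    { approx := .const
      null := fun _ _ h => .of_forall fun _ => h
      integral_prod := fun h hm hb => by
        refine ⟨fun p => (∫ y, h p.1 y ∂μ) ^ p.1, fun N => measurable_const (a := (∫ y, h N y ∂μ) ^ N),
          fun p => ?_, .of_forall fun _ => rfl, fun N => ?_⟩
        · rw [norm_pow]
          exact pow_le_one₀ (norm_nonneg _) (norm_integral_le_one (hb _))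
        · rw [integral_fintype_prod_eq_pow]
          simp }
  refine ⟨fun B hB h => hc.avoids hB h, fun f hf hfi => hc.lln hf hfi, fun f hf hf2 hf0 t => ?_⟩
  have h := hc.clt hf (integrable_of_integrable_sq hf.aestronglyMeasurable hf2) hf2 hf0
    (S := fun _ => 0) (fun _ => measurable_const) t 0 (by simpa [hf0] using tendsto_const_nhds) (by simp)
  simpa only [add_zero] using h

end Step

/-! ### The `L²` deviation of a kernel from its invariant measure -/

section L2Deviation

variable {X : Type*} [MeasurableSpace X] {ν : Measure X}

lemma eLpNorm_two_eq_ofReal_sqrt {f : X → ℝ} (hf : AEStronglyMeasurable f ν)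
    (hf2 : Integrable (fun x => f x ^ 2) ν) :
    eLpNorm f 2 ν = ENNReal.ofReal √(∫ x, f x ^ 2 ∂ν) := by
  rw [((memLp_two_iff_integrable_sq hf).2 hf2).eLpNorm_eq_integral_rpow_norm (by norm_num)
    (by norm_num), Real.sqrt_eq_rpow]
  simp

lemma l2Deviation_nonneg (κ : Kernel X X) (ν : Measure X) : 0 ≤ l2Deviation κ ν := by
  refine Real.sSup_nonneg ?_
  rintro _ ⟨f, -, -, rfl⟩
  exact ENNReal.toReal_nonneg

variable {κ : Kernel X X} [IsMarkovKernel κ] [IsProbabilityMeasure ν] {f : X → ℝ}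

lemma integrable_sq_deviation (hκ : Kernel.Invariant κ ν) (hf : Measurable f)
    (hf2 : Integrable (fun x => f x ^ 2) ν) :
    Integrable (fun x => (∫ y, f y ∂(κ x) - ∫ y, f y ∂ν) ^ 2) ν := by
  have hm : AEStronglyMeasurable (fun x => ∫ y, f y ∂(κ x)) ν :=
    hf.stronglyMeasurable.integral_kernel.aestronglyMeasurable
  refine (memLp_two_iff_integrable_sq (hm.sub aestronglyMeasurable_const)).1 ?_
  exact ((memLp_two_iff_integrable_sq hm).2 (integrable_sq_integral_of_invariant hκ hf hf2)).sub
    (memLp_const _)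

/-- Pythagoras: by invariance `κf - ν(f)` has mean zero, hence is orthogonal to constants. -/
lemma integral_sq_deviation_add (hκ : Kernel.Invariant κ ν) (hf : Measurable f)
    (hf2 : Integrable (fun x => f x ^ 2) ν) :
    ∫ x, (∫ y, f y ∂(κ x)) ^ 2 ∂ν =
      ∫ x, (∫ y, f y ∂(κ x) - ∫ y, f y ∂ν) ^ 2 ∂ν + (∫ y, f y ∂ν) ^ 2 := by
  have hfi := integrable_of_integrable_sq hf.aestronglyMeasurable hf2
  have hKi := integrable_integral_of_invariant hκ hfi
  have hK := integral_integral_of_invariant hκ hfi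
  have h1 : ∀ x, (∫ y, f y ∂(κ x)) ^ 2 = (∫ y, f y ∂(κ x) - ∫ y, f y ∂ν) ^ 2 +
      (2 * (∫ y, f y ∂ν) * ∫ y, f y ∂(κ x) - (∫ y, f y ∂ν) ^ 2) := fun x => by ring
  simp only [h1]
  have h2 : Integrable (fun x => 2 * (∫ y, f y ∂ν) * ∫ y, f y ∂(κ x) - (∫ y, f y ∂ν) ^ 2) ν :=
    (hKi.const_mul _).sub (integrable_const _)
  rw [integral_add (integrable_sq_deviation hκ hf hf2) h2,
    integral_sub (hKi.const_mul _) (integrable_const _), integral_const_mul, hK, integral_const,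
    probReal_univ, one_smul]
  ring

lemma sqrt_integral_sq_deviation_le (hκ : Kernel.Invariant κ ν) (hf : Measurable f)
    (hf2 : Integrable (fun x => f x ^ 2) ν) (hf1 : ∫ x, f x ^ 2 ∂ν ≤ 1) :
    √(∫ x, (∫ y, f y ∂(κ x) - ∫ y, f y ∂ν) ^ 2 ∂ν) ≤ l2Deviation κ ν := by
  have hdev : ∀ f : X → ℝ, Measurable f → Integrable (fun x => f x ^ 2) ν →
      (eLpNorm (fun x => ∫ y, f y ∂(κ x) - ∫ y, f y ∂ν) 2 ν).toReal =
        √(∫ x, (∫ y, f y ∂(κ x) - ∫ y, f y ∂ν) ^ 2 ∂ν) := fun f hf hf2 => by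
    have hm : AEStronglyMeasurable (fun x => ∫ y, f y ∂(κ x) - ∫ y, f y ∂ν) ν :=
      hf.stronglyMeasurable.integral_kernel.aestronglyMeasurable.sub aestronglyMeasurable_const
    rw [eLpNorm_two_eq_ofReal_sqrt hm
      (integrable_sq_deviation hκ hf hf2), ENNReal.toReal_ofReal (Real.sqrt_nonneg _)]
  refine le_csSup ⟨1, ?_⟩ ⟨f, hf, ?_, (hdev f hf hf2).symm⟩
  -- The supremum is over a set bounded by `1`: the deviation of `u` is at most the norm of `κu`,
  -- hence of `u`.
  · rintro _ ⟨u, hu, hu1, rfl⟩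
    have hu2 : Integrable (fun x => u x ^ 2) ν :=
      (memLp_two_iff_integrable_sq hu.aestronglyMeasurable).1
        ⟨hu.aestronglyMeasurable, hu1.trans_lt ENNReal.one_lt_top⟩
    rw [hdev u hu hu2]
    rw [eLpNorm_two_eq_ofReal_sqrt hu.aestronglyMeasurable hu2, ENNReal.ofReal_le_one] at hu1
    refine (Real.sqrt_le_sqrt ?_).trans hu1
    have h1 := integral_sq_deviation_add hκ hu hu2
    have h2 := integral_sq_integral_le_of_invariant hκ hu hu2
    nlinarith [sq_nonneg (∫ y, u y ∂ν)]
  · rw [eLpNorm_two_eq_ofReal_sqrt hf.aestronglyMeasurable hf2, ENNReal.ofReal_le_one]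
    exact Real.sqrt_le_one.2 hf1

lemma integral_sq_deviation_le (hκ : Kernel.Invariant κ ν) (hf : Measurable f)
    (hf2 : Integrable (fun x => f x ^ 2) ν) :
    ∫ x, (∫ y, f y ∂(κ x) - ∫ y, f y ∂ν) ^ 2 ∂ν ≤ l2Deviation κ ν ^ 2 * ∫ x, f x ^ 2 ∂ν := by
  have hN : 0 ≤ ∫ x, f x ^ 2 ∂ν := integral_nonneg fun x => sq_nonneg _
  -- Homogeneity: `f` is rescaled to norm at most one. Adding `δ` avoids dividing by zero when `f`
  -- vanishes almost everywhere, and `δ → 0` at the end.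
  have key : ∀ δ : ℝ, 0 < δ → ∫ x, (∫ y, f y ∂(κ x) - ∫ y, f y ∂ν) ^ 2 ∂ν ≤
      l2Deviation κ ν ^ 2 * (∫ x, f x ^ 2 ∂ν + δ) := by
    intro δ hδ
    set M := ∫ x, f x ^ 2 ∂ν + δ
    have hM : 0 < M := by positivity
    have hc : (√M)⁻¹ ^ 2 = M⁻¹ := by rw [inv_pow, Real.sq_sqrt hM.le]
    have h := sqrt_integral_sq_deviation_le (f := fun x => (√M)⁻¹ * f x) hκ (by fun_prop)
      (by simpa only [mul_pow] using hf2.const_mul _) ?_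
    · simp only [integral_const_mul, ← mul_sub, mul_pow, hc] at h
      have h2 := pow_le_pow_left₀ (Real.sqrt_nonneg _) h 2
      rw [Real.sq_sqrt (by positivity), inv_mul_le_iff₀ hM] at h2
      rwa [mul_comm M] at h2
    · simp only [mul_pow, hc, integral_const_mul]
      rw [inv_mul_le_iff₀ hM]
      linarith
  have hlim : Tendsto (fun δ : ℝ => l2Deviation κ ν ^ 2 * (∫ x, f x ^ 2 ∂ν + δ)) (𝓝[>] 0)
      (𝓝 (l2Deviation κ ν ^ 2 * (∫ x, f x ^ 2 ∂ν + 0))) :=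
    (Continuous.tendsto (by fun_prop) 0).mono_left nhdsWithin_le_nhds
  rw [add_zero] at hlim
  exact ge_of_tendsto hlim (eventually_nhdsWithin_of_forall fun δ hδ => key δ hδ)

end L2Deviation

/-! ### Restriction to a single mode -/

section Mode

variable {ν : Measure E} {K : Kernel E E} {S : Set E}

/-- If `K` neither leaves nor enters `S`, then the restriction of an invariant measure to `S` is
invariant. -/
lemma invariant_restrict [IsMarkovKernel K] (hK : Kernel.Invariant K ν) (hS : MeasurableSet S)
    (hin : ∀ x ∈ S, K x S = 1) (hout : ∀ x ∉ S, K x S = 0) :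
    Kernel.Invariant K (ν.restrict S) := by
  ext B hB
  have h1 : ∀ x ∈ S, K x B = K x (B ∩ S) := fun x hx => by
    have : K x Sᶜ = 0 := (prob_compl_eq_zero_iff hS).2 (hin x hx)
    exact (measure_inter_conull (t := S) this).symm
  have h2 : ∀ x ∉ S, K x (B ∩ S) = 0 := fun x hx =>
    measure_mono_null Set.inter_subset_right (hout x hx)
  rw [Measure.bind_apply hB K.aemeasurable, setLIntegral_congr_fun hS h1,
    setLIntegral_eq_of_support_subset, Measure.restrict_apply hB]
  · rw [← Measure.bind_apply (hB.inter hS) K.aemeasurable, hK.def]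
  · intro x hx
    by_contra hc
    exact hx (h2 x hc)

lemma isProbabilityMeasure_modeMeasure [IsFiniteMeasure ν] (hS : MeasurableSet S) (h0 : ν S ≠ 0) :
    IsProbabilityMeasure (modeMeasure ν S) := by
  have := cond_isProbabilityMeasure h0
  refine ⟨?_⟩
  rw [modeMeasure, comap_subtype_coe_apply hS, Set.image_univ, Subtype.range_coe,
    cond_apply hS, Set.inter_self, ENNReal.inv_mul_cancel h0 (measure_ne_top _ _)]

lemma integral_modeMeasure (hS : MeasurableSet S) (f : E → ℝ) :
    ∫ x : S, f x ∂(modeMeasure ν S) = (ν.real S)⁻¹ * ∫ x in S, f x ∂ν := by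
  rw [modeMeasure, integral_subtype_comap hS, ProbabilityTheory.cond, Measure.restrict_smul,
    Measure.restrict_restrict hS, Set.inter_self, integral_smul_measure, smul_eq_mul,
    ENNReal.toReal_inv, measureReal_def]

lemma isMarkovKernel_modeKernel (hS : MeasurableSet S) (hin : ∀ x ∈ S, K x S = 1) :
    IsMarkovKernel (modeKernel K hS) := by
  refine ⟨fun x => ⟨?_⟩⟩
  rw [modeKernel, Kernel.comapRight_apply, Kernel.comap_apply, comap_subtype_coe_apply hS,
    Set.image_univ, Subtype.range_coe, hin x x.2]

lemma integral_modeKernel [IsMarkovKernel K] (hS : MeasurableSet S) (hin : ∀ x ∈ S, K x S = 1)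
    (f : E → ℝ) (x : S) : ∫ y : S, f y ∂(modeKernel K hS x) = ∫ y, f y ∂(K x) := by
  rw [modeKernel, Kernel.comapRight_apply, Kernel.comap_apply, integral_subtype_comap hS]
  congr 1
  exact Measure.restrict_eq_self_of_ae_mem
    ((prob_compl_eq_zero_iff hS).2 (hin x x.2) : K x Sᶜ = 0)

lemma invariant_modeKernel [IsMarkovKernel K] (hK : Kernel.Invariant K ν) (hS : MeasurableSet S)
    (hin : ∀ x ∈ S, K x S = 1) (hout : ∀ x ∉ S, K x S = 0) :
    Kernel.Invariant (modeKernel K hS) (modeMeasure ν S) := by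
  ext B hB
  have hB' : MeasurableSet (Subtype.val '' B : Set E) := hS.subtype_image hB
  have hlin : ∀ f : E → ℝ≥0∞, ∫⁻ x : S, f x ∂(modeMeasure ν S) = (ν S)⁻¹ * ∫⁻ x in S, f x ∂ν := by
    intro f
    rw [modeMeasure, lintegral_subtype_comap hS, ProbabilityTheory.cond, Measure.restrict_smul,
      Measure.restrict_restrict hS, Set.inter_self, lintegral_smul_measure, smul_eq_mul]
  have hap : ∀ x : S, modeKernel K hS x B = K x (Subtype.val '' B) := fun x => by
    rw [modeKernel, Kernel.comapRight_apply, Kernel.comap_apply, comap_subtype_coe_apply hS]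
  rw [Measure.bind_apply hB (Kernel.aemeasurable _)]
  simp only [hap]
  rw [hlin fun x => K x (Subtype.val '' B), ← Measure.bind_apply hB' K.aemeasurable,
    (invariant_restrict hK hS hin hout).def, modeMeasure, comap_subtype_coe_apply hS,
    ProbabilityTheory.cond, Measure.smul_apply, smul_eq_mul]

/-- The contraction estimate within a mode. -/
lemma setIntegral_sq_integral_le [IsFiniteMeasure ν] [IsMarkovKernel K] (hK : Kernel.Invariant K ν)
    (hS : MeasurableSet S) (h0 : ν S ≠ 0) (hin : ∀ x ∈ S, K x S = 1) (hout : ∀ x ∉ S, K x S = 0)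
    {f : E → ℝ} (hf : Measurable f) (hf2 : Integrable (fun x => f x ^ 2) ν) :
    ∫ x in S, (∫ y, f y ∂(K x)) ^ 2 ∂ν ≤
      l2Deviation (modeKernel K hS) (modeMeasure ν S) ^ 2 * ∫ x in S, f x ^ 2 ∂ν +
        (∫ x in S, f x ∂ν) ^ 2 / ν.real S := by
  have := isProbabilityMeasure_modeMeasure hS h0
  have := isMarkovKernel_modeKernel hS hin
  have hinv := invariant_modeKernel hK hS hin hout
  have hc : 0 < ν.real S := ENNReal.toReal_pos h0 (measure_ne_top _ _)
  have hfm : Measurable fun x : S => f x := hf.comp measurable_subtype_coe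
  have hfi : Integrable (fun x : S => f x ^ 2) (modeMeasure ν S) := by
    rw [modeMeasure, ← Function.comp_def (fun x : E => f x ^ 2) Subtype.val,
      ← (MeasurableEmbedding.subtype_coe hS).integrable_map_iff,
      (MeasurableEmbedding.subtype_coe hS).map_comap, Subtype.range_coe, ProbabilityTheory.cond,
      Measure.restrict_smul]
    exact (hf2.restrict.restrict).smul_measure (ENNReal.inv_ne_top.2 h0)
  -- `Kf` splits orthogonally into its mode mean and a deviation. Only the deviation contracts; the
  -- squared mean, after undoing the normalisation, is the last term.
  have h1 := integral_sq_deviation_add hinv hfm hfi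
  have h2 := integral_sq_deviation_le hinv hfm hfi
  simp only [integral_modeKernel hS hin f] at h1 h2
  rw [integral_modeMeasure hS fun x => (∫ y, f y ∂(K x)) ^ 2] at h1
  rw [integral_modeMeasure hS fun x => f x ^ 2] at h2
  rw [integral_modeMeasure hS f] at h1 h2
  set c := ν.real S
  set I := ∫ x in S, f x ∂ν
  set L := l2Deviation (modeKernel K hS) (modeMeasure ν S)
  have h3 : c⁻¹ * ∫ x in S, (∫ y, f y ∂(K x)) ^ 2 ∂ν ≤
      L ^ 2 * (c⁻¹ * ∫ x in S, f x ^ 2 ∂ν) + (c⁻¹ * I) ^ 2 := by linarith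
  rw [inv_mul_le_iff₀ hc] at h3
  refine h3.trans_eq ?_
  field_simp

end Mode

lemma coe_le_maxDensity {X : Type*} {g : ℕ → X → ℝ≥0} {n : ℕ}
    (hgb : ∀ k < n, BddAbove (Set.range fun x => (g k x : ℝ))) {k : ℕ}
    (hk : k < n) (x : X) : (g k x : ℝ) ≤ maxDensity g n :=
  (le_ciSup (hgb k hk) x).trans
    (le_ciSup (f := fun k : Fin n => ⨆ x : X, (g k x : ℝ)) (Set.finite_range _).bddAbove ⟨k, hk⟩)

lemma maxDensity_nonneg {X : Type*} {g : ℕ → X → ℝ≥0} {n : ℕ} : 0 ≤ maxDensity g n :=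
  Real.iSup_nonneg fun _ => Real.iSup_nonneg fun _ => NNReal.coe_nonneg _

/-! ### The propagated test function -/

section Propagate

variable {μ : ℕ → Measure E} {g : ℕ → E → ℝ≥0} {K : ℕ → Kernel E E}

lemma measurable_propagate (hg : ∀ k, Measurable (g k)) {φ : E → ℝ} (hφ : Measurable φ)
    (d : ℕ) : ∀ k, Measurable (propagate g K φ k d) := by
  induction d with
  | zero => exact fun k => hφ
  | succ d ih =>
    intro k
    have h := (ih (k + 1)).stronglyMeasurable.integral_kernel (κ := K (k + 1)) |>.measurable
    have h' := hg k
    simp only [propagate]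
    fun_prop

/-- The definition peels off the earliest stage, whereas the induction for the limit theorem peels
off the latest. -/
lemma propagate_succ_right (φ : E → ℝ) (d : ℕ) : ∀ k n, k + d = n →
    propagate g K φ k (d + 1) =
      propagate g K (fun x => g n x * ∫ y, φ y ∂(K (n + 1) x)) k d := by
  induction d with
  | zero => rintro k n rfl; rfl
  | succ d ih =>
    intro k n hn
    have h := ih (k + 1) n (by omega)
    rw [propagate, h, propagate]

lemma asymptoticVariance_succ (φ : E → ℝ) (n : ℕ) :
    asymptoticVariance μ g K φ (n + 1) = ∫ x, φ x ^ 2 ∂(μ (n + 1)) +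
      asymptoticVariance μ g K (fun x => g n x * ∫ y, φ y ∂(K (n + 1) x)) n := by
  rw [asymptoticVariance, Finset.sum_range_succ, add_comm, asymptoticVariance]
  congr 1
  · simp [stageVariance, propagate]
  · refine Finset.sum_congr rfl fun k hk => ?_
    have hk' : k ≤ n := Nat.lt_succ_iff.1 (Finset.mem_range.1 hk)
    rw [stageVariance, stageVariance, Nat.succ_sub hk',
      propagate_succ_right φ (n - k) k n (by omega)]

lemma asymptoticVariance_nonneg (φ : E → ℝ) (n : ℕ) : 0 ≤ asymptoticVariance μ g K φ n :=
  Finset.sum_nonneg fun _ _ => integral_nonneg fun _ => sq_nonneg _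

end Propagate

lemma l2Deviation_le_one_sub_localGap {μ : ℕ → Measure E} {K : ℕ → Kernel E E} {n m : ℕ}
    {F : Fin m → Set E} (hF : ∀ r, MeasurableSet (F r)) {k : ℕ} (hk : k < n)
    (r : Fin m) : l2Deviation (modeKernel (K (k + 1)) (hF r)) (modeMeasure (μ (k + 1)) (F r)) ≤
      1 - localGap μ K F hF n := by
  rw [localGap, sub_sub_cancel]
  refine (le_ciSup (f := fun r : Fin m => l2Deviation (modeKernel (K (k + 1)) (hF r))
    (modeMeasure (μ (k + 1)) (F r))) (Set.finite_range _).bddAbove r).trans ?_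
  exact le_ciSup (f := fun k : Fin n => ⨆ r : Fin m, l2Deviation
    (modeKernel (K (k + 1)) (hF r)) (modeMeasure (μ (k + 1)) (F r)))
    (Set.finite_range _).bddAbove ⟨k, hk⟩

/-! ### The particle system: limit theorem -/

section Model

variable {n : ℕ} {μ : ℕ → Measure E} {g : ℕ → E → ℝ≥0}
  {K : ℕ → Kernel E E} [∀ k, IsMarkovKernel (K k)] {φ : E → ℝ}

lemma integrable_sq_propagate (hg : ∀ k, Measurable (g k))
    (hμg : ∀ k < n, μ (k + 1) = (μ k).withDensity fun x => (g k x : ℝ≥0∞))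
    (hgb : ∀ k < n, BddAbove (Set.range fun x => (g k x : ℝ)))
    (hK : ∀ k, 1 ≤ k → k ≤ n → Kernel.Invariant (K k) (μ k)) (hφ : Measurable φ)
    (hφ2 : Integrable (fun x => φ x ^ 2) (μ n)) (d : ℕ) :
    ∀ k, k + d = n → Integrable (fun x => propagate g K φ k d x ^ 2) (μ k) := by
  induction d with
  | zero => rintro k rfl; exact hφ2
  | succ d ih =>
    intro k hk
    exact integrable_sq_mul_of_density (hg k) (hμg k (by omega))
      (coe_le_maxDensity hgb (by omega))
      ((measurable_propagate hg hφ d (k + 1)).stronglyMeasurable.integral_kernel).measurable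
      (integrable_sq_integral_of_invariant (hK (k + 1) (by omega) (by omega))
        (measurable_propagate hg hφ d (k + 1)) (ih (k + 1) (by omega)))

lemma integral_sq_propagate_succ_le (hg : ∀ k, Measurable (g k))
    (hμg : ∀ k < n, μ (k + 1) = (μ k).withDensity fun x => (g k x : ℝ≥0∞))
    (hgb : ∀ k < n, BddAbove (Set.range fun x => (g k x : ℝ)))
    (hK : ∀ k, 1 ≤ k → k ≤ n → Kernel.Invariant (K k) (μ k)) (hφ : Measurable φ)
    (hφ2 : Integrable (fun x => φ x ^ 2) (μ n)) {d k : ℕ} (hk : k + (d + 1) = n) :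
    ∫ x, propagate g K φ k (d + 1) x ^ 2 ∂(μ k) ≤
      maxDensity g n * ∫ x, (∫ y, propagate g K φ (k + 1) d y ∂(K (k + 1) x)) ^ 2 ∂(μ (k + 1)) :=
  integral_sq_mul_le_of_density (hg k) (hμg k (by omega)) (coe_le_maxDensity hgb (by omega))
    ((measurable_propagate hg hφ d (k + 1)).stronglyMeasurable.integral_kernel).measurable
    (integrable_sq_integral_of_invariant (hK (k + 1) (by omega) (by omega))
      (measurable_propagate hg hφ d (k + 1))
      (integrable_sq_propagate hg hμg hgb hK hφ hφ2 d (k + 1) (by omega)))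

variable [∀ k, IsProbabilityMeasure (μ k)]

/-- Law of large numbers and central limit theorem for the particle system. -/
lemma obeysLimitTheorems_particleLaw (hg : ∀ k, Measurable (g k))
    (hμg : ∀ k < n, μ (k + 1) = (μ k).withDensity fun x => (g k x : ℝ≥0∞))
    (hgb : ∀ k < n, BddAbove (Set.range fun x => (g k x : ℝ)))
    (hK : ∀ k, 1 ≤ k → k ≤ n → Kernel.Invariant (K k) (μ k)) {k : ℕ} (hk : k ≤ n) :
    ObeysLimitTheorems (fun N => particleLaw (μ 0) g hg K N k) (μ k)
      (fun f => asymptoticVariance μ g K f k) := by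
  induction k with
  | zero =>
    have h := obeysLimitTheorems_pi (μ := μ 0)
    simpa [asymptoticVariance, stageVariance, propagate, particleLaw] using h
  | succ k ih =>
    have h := (ih (by omega)).stepLaw (hg k) (coe_le_maxDensity hgb (by omega)) (hμg k (by omega))
      (hK (k + 1) (by omega) hk)
    simp only [asymptoticVariance_succ]
    exact h

lemma measurable_scaledError (ν : Measure E) (hφ : Measurable φ) (N : ℕ) :
    Measurable (scaledError ν φ N) :=
  ((measurable_empMean hφ N).sub_const (∫ y, φ y ∂ν)).const_mul √(N : ℝ)

lemma tendstoInDistribution_scaledError (hg : ∀ k, Measurable (g k))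
    (hμg : ∀ k < n, μ (k + 1) = (μ k).withDensity fun x => (g k x : ℝ≥0∞))
    (hgb : ∀ k < n, BddAbove (Set.range fun x => (g k x : ℝ)))
    (hK : ∀ k, 1 ≤ k → k ≤ n → Kernel.Invariant (K k) (μ k)) (hφ : Measurable φ)
    (hφ2 : Integrable (fun x => φ x ^ 2) (μ n)) (hφ0 : ∫ x, φ x ∂(μ n) = 0) :
    TendstoInDistribution (fun N : ℕ => scaledError (μ n) φ N) atTop (id : ℝ → ℝ)
      (fun N : ℕ => particleLaw (μ 0) g hg K N n)
      (gaussianReal 0 (asymptoticVariance μ g K φ n).toNNReal) where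
  forall_aemeasurable N := (measurable_scaledError _ hφ N).aemeasurable
  aemeasurable_limit := aemeasurable_id
  tendsto := by
    refine ProbabilityMeasure.tendsto_iff_tendsto_charFun.2 fun t => ?_
    simp only [ProbabilityMeasure.coe_mk, Measure.map_id, charFun_gaussianReal]
    have h := (obeysLimitTheorems_particleLaw hg hμg hgb hK le_rfl).clt φ hφ hφ2 hφ0 t
    rw [Real.coe_toNNReal _ (asymptoticVariance_nonneg φ n)]
    have he : Complex.exp (t * (0 : ℝ) * Complex.I - (asymptoticVariance μ g K φ n : ℝ) * t ^ 2 / 2)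
        = Complex.exp (-(t ^ 2 * asymptoticVariance μ g K φ n) / 2 : ℝ) := by
      congr 1
      push_cast; ring
    rw [he]
    refine h.congr fun N => ?_
    rw [charFun_apply_real, integral_map (measurable_scaledError _ hφ N).aemeasurable
      (by fun_prop)]
    simp [scaledError, empMean, hφ0]

/-! ### The particle system: variance bound -/

variable {m : ℕ} {F : Fin m → Set E}

lemma kernel_eq_zero_of_notMem {κ : Kernel E E} [IsMarkovKernel κ]
    (hF : ∀ r, MeasurableSet (F r)) (hFdisj : Pairwise fun r s => Disjoint (F r) (F s))
    (hFcover : ⋃ r, F r = Set.univ) (hκ : ∀ r, ∀ x ∈ F r, κ x (F r) = 1) {r : Fin m} {x : E}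
    (hx : x ∉ F r) : κ x (F r) = 0 := by
  obtain ⟨s, hs⟩ := Set.mem_iUnion.1 (hFcover ▸ Set.mem_univ x : x ∈ ⋃ r, F r)
  have hsr : s ≠ r := fun h => hx (h ▸ hs)
  exact measure_mono_null (hFdisj hsr).subset_compl_left
    ((prob_compl_eq_zero_iff (hF s)).2 (hκ s x hs))

lemma sum_setIntegral_eq {ν : Measure E} (hF : ∀ r, MeasurableSet (F r))
    (hFdisj : Pairwise fun r s => Disjoint (F r) (F s)) (hFcover : ⋃ r, F r = Set.univ)
    {f : E → ℝ} (hf : Integrable f ν) : ∑ r, ∫ x in F r, f x ∂ν = ∫ x, f x ∂ν := by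
  rw [← integral_iUnion_fintype hF hFdisj fun r => hf.integrableOn, hFcover, setIntegral_univ]

lemma sum_measureReal_eq_one {ν : Measure E} [IsProbabilityMeasure ν]
    (hF : ∀ r, MeasurableSet (F r)) (hFdisj : Pairwise fun r s => Disjoint (F r) (F s))
    (hFcover : ⋃ r, F r = Set.univ) : ∑ r, ν.real (F r) = 1 := by
  simpa using sum_setIntegral_eq (ν := ν) hF hFdisj hFcover (integrable_const (1 : ℝ))

lemma measureReal_le_growthWithinMode_mul {j k : ℕ} (hjk : j < k) (hk : k ≤ n) {r : Fin m}
    (h0 : μ j (F r) ≠ 0) :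
    (μ k).real (F r) ≤ growthWithinMode μ F n * (μ j).real (F r) := by
  have hpos : 0 < (μ j).real (F r) := ENNReal.toReal_pos h0 (measure_ne_top _ _)
  rw [← div_le_iff₀ hpos]
  refine le_csSup ?_ ⟨j, k, r, hjk, hk, rfl⟩
  refine ((Set.finite_range fun q : Fin (n + 1) × Fin (n + 1) × Fin m =>
    (μ q.2.1).real (F q.2.2) / (μ q.1).real (F q.2.2)).subset ?_).bddAbove
  rintro _ ⟨j, k, r, hjk, hk, rfl⟩
  exact ⟨⟨⟨j, by omega⟩, ⟨k, by omega⟩, r⟩, rfl⟩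

/-- The mode masses sum to one at stage `0` and at stage `1`, so the ratios cannot all be below `1`.
-/
lemma one_le_growthWithinMode (hn : 1 ≤ n)
    (hμg : ∀ k < n, μ (k + 1) = (μ k).withDensity fun x => (g k x : ℝ≥0∞))
    (hF : ∀ r, MeasurableSet (F r)) (hFdisj : Pairwise fun r s => Disjoint (F r) (F s))
    (hFcover : ⋃ r, F r = Set.univ) (hFpos : ∀ k, 1 ≤ k → k ≤ n → ∀ r, 0 < μ k (F r)) :
    1 ≤ growthWithinMode μ F n := by
  -- Positivity is assumed only from stage `1` on; at stage `0` it follows from `μ 1 ≪ μ 0`.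
  have h0 : ∀ r, μ 0 (F r) ≠ 0 := fun r h => by
    have hac : μ 1 ≪ μ 0 := by
      have h1 := hμg 0 (by omega)
      rw [zero_add] at h1
      rw [h1]
      exact withDensity_absolutelyContinuous _ _
    exact (hFpos 1 le_rfl hn r).ne' (hac h)
  calc (1 : ℝ) = ∑ r, (μ 1).real (F r) := (sum_measureReal_eq_one hF hFdisj hFcover).symm
    _ ≤ ∑ r, growthWithinMode μ F n * (μ 0).real (F r) :=
        Finset.sum_le_sum fun r _ => measureReal_le_growthWithinMode_mul zero_lt_one hn (h0 r)
    _ = growthWithinMode μ F n := by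
        rw [← Finset.mul_sum, sum_measureReal_eq_one hF hFdisj hFcover, mul_one]

/-- The mass that the propagated test function gives to a mode does not change. -/
lemma setIntegral_propagate (hg : ∀ k, Measurable (g k))
    (hμg : ∀ k < n, μ (k + 1) = (μ k).withDensity fun x => (g k x : ℝ≥0∞))
    (hgb : ∀ k < n, BddAbove (Set.range fun x => (g k x : ℝ)))
    (hK : ∀ k, 1 ≤ k → k ≤ n → Kernel.Invariant (K k) (μ k)) (hφ : Measurable φ)
    (hφ2 : Integrable (fun x => φ x ^ 2) (μ n)) {S : Set E} (hS : MeasurableSet S)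
    (hin : ∀ k, 1 ≤ k → k ≤ n → ∀ x ∈ S, K k x S = 1)
    (hout : ∀ k, 1 ≤ k → k ≤ n → ∀ x ∉ S, K k x S = 0) (d : ℕ) :
    ∀ k, k + d = n → ∫ x in S, propagate g K φ k d x ∂(μ k) = ∫ x in S, φ x ∂(μ n) := by
  induction d with
  | zero => rintro k rfl; rfl
  | succ d ih =>
    intro k hk
    rw [← ih (k + 1) (by omega)]
    have hinv := invariant_restrict (hK (k + 1) (by omega) (by omega)) hS
      (hin (k + 1) (by omega) (by omega)) (hout (k + 1) (by omega) (by omega))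
    have hμS : (μ (k + 1)).restrict S =
        ((μ k).restrict S).withDensity fun x => (g k x : ℝ≥0∞) := by
      rw [hμg k (by omega), restrict_withDensity hS]
    have hm := measurable_propagate (K := K) hg hφ d (k + 1)
    have hi : Integrable (propagate g K φ (k + 1) d) (μ (k + 1)) :=
      integrable_of_integrable_sq hm.aestronglyMeasurable
        (integrable_sq_propagate hg hμg hgb hK hφ hφ2 d (k + 1) (by omega))
    rw [← integral_integral_of_invariant hinv hi.restrict, ← integral_mul_of_density (hg k) hμS]
    rfl

/-- One step of the recursion for the stage variances. -/
lemma integral_sq_integral_propagate_le (hg : ∀ k, Measurable (g k))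
    (hμg : ∀ k < n, μ (k + 1) = (μ k).withDensity fun x => (g k x : ℝ≥0∞))
    (hgb : ∀ k < n, BddAbove (Set.range fun x => (g k x : ℝ)))
    (hK : ∀ k, 1 ≤ k → k ≤ n → Kernel.Invariant (K k) (μ k))
    (hF : ∀ r, MeasurableSet (F r)) (hFdisj : Pairwise fun r s => Disjoint (F r) (F s))
    (hFcover : ⋃ r, F r = Set.univ) (hFpos : ∀ k, 1 ≤ k → k ≤ n → ∀ r, 0 < μ k (F r))
    (hnomix : ∀ k, 1 ≤ k → k ≤ n → ∀ r, ∀ x ∈ F r, K k x (F r) = 1) (hφ : Measurable φ)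
    (hφ2 : Integrable (fun x => φ x ^ 2) (μ n)) {d k : ℕ} (hk : k + 1 + d = n) (hd : 1 ≤ d) :
    ∫ x, (∫ y, propagate g K φ (k + 1) d y ∂(K (k + 1) x)) ^ 2 ∂(μ (k + 1)) ≤
      (1 - localGap μ K F hF n) ^ 2 * ∫ x, propagate g K φ (k + 1) d x ^ 2 ∂(μ (k + 1)) +
        growthWithinMode μ F n * ∫ x, φ x ^ 2 ∂(μ n) := by
  have hout : ∀ r k, 1 ≤ k → k ≤ n → ∀ x ∉ F r, K k x (F r) = 0 := fun r k h1 h2 x hx =>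
    kernel_eq_zero_of_notMem hF hFdisj hFcover (hnomix k h1 h2) hx
  have hinv := hK (k + 1) (by omega) (by omega)
  have hm := measurable_propagate (K := K) hg hφ d (k + 1)
  have hq2 := integrable_sq_propagate hg hμg hgb hK hφ hφ2 d (k + 1) hk
  rw [← sum_setIntegral_eq hF hFdisj hFcover (integrable_sq_integral_of_invariant hinv hm hq2),
    ← sum_setIntegral_eq hF hFdisj hFcover hq2, ← sum_setIntegral_eq hF hFdisj hFcover hφ2,
    Finset.mul_sum, Finset.mul_sum, ← Finset.sum_add_distrib]
  refine Finset.sum_le_sum fun r _ => ?_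
  have h0 := (hFpos (k + 1) (by omega) (by omega) r).ne'
  refine (setIntegral_sq_integral_le hinv (hF r) h0 (hnomix (k + 1) (by omega) (by omega) r)
    (hout r (k + 1) (by omega) (by omega)) hm hq2).trans (add_le_add ?_ ?_)
  · exact mul_le_mul_of_nonneg_right (pow_le_pow_left₀ (l2Deviation_nonneg _ _)
      (l2Deviation_le_one_sub_localGap hF (by omega) r) 2) (integral_nonneg fun x => sq_nonneg _)
  · have hc : 0 < (μ (k + 1)).real (F r) := ENNReal.toReal_pos h0 (measure_ne_top _ _)
    rw [setIntegral_propagate hg hμg hgb hK hφ hφ2 (hF r) (fun k h1 h2 => hnomix k h1 h2 r)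
      (hout r) d (k + 1) hk, div_le_iff₀ hc]
    have hcs := sq_integral_le_measureReal_mul (ν := (μ n).restrict (F r))
      (integrable_of_integrable_sq hφ.aestronglyMeasurable hφ2.restrict) hφ2.restrict
    rw [measureReal_restrict_apply_univ] at hcs
    -- This ratio is counted in `growthWithinMode` only if `k + 1 < n`, which is what `hd` ensures.
    have hA := measureReal_le_growthWithinMode_mul (μ := μ) (F := F) (j := k + 1) (k := n)
      (by omega) le_rfl h0
    have hnn : 0 ≤ ∫ x in F r, φ x ^ 2 ∂(μ n) := integral_nonneg fun x => sq_nonneg _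
    calc _ ≤ (μ n).real (F r) * ∫ x in F r, φ x ^ 2 ∂(μ n) := hcs
      _ ≤ _ := mul_le_mul_of_nonneg_right hA hnn
      _ = _ := by ring

lemma asymptoticVariance_le (hn : 1 ≤ n) (hg : ∀ k, Measurable (g k))
    (hμg : ∀ k < n, μ (k + 1) = (μ k).withDensity fun x => (g k x : ℝ≥0∞))
    (hgb : ∀ k < n, BddAbove (Set.range fun x => (g k x : ℝ)))
    (hK : ∀ k, 1 ≤ k → k ≤ n → Kernel.Invariant (K k) (μ k))
    (hF : ∀ r, MeasurableSet (F r)) (hFdisj : Pairwise fun r s => Disjoint (F r) (F s))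
    (hFcover : ⋃ r, F r = Set.univ) (hFpos : ∀ k, 1 ≤ k → k ≤ n → ∀ r, 0 < μ k (F r))
    (hnomix : ∀ k, 1 ≤ k → k ≤ n → ∀ r, ∀ x ∈ F r, K k x (F r) = 1)
    (hΓγ : (1 - localGap μ K F hF n) ^ 2 * maxDensity g n < 1) (hφ : Measurable φ)
    (hφ2 : Integrable (fun x => φ x ^ 2) (μ n)) :
    asymptoticVariance μ g K φ n ≤
      (1 + n * growthWithinMode μ F n * maxDensity g n /
        (1 - (1 - localGap μ K F hF n) ^ 2 * maxDensity g n)) * ∫ x, φ x ^ 2 ∂(μ n) := by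
  set ρ := (1 - localGap μ K F hF n) ^ 2 with hρ
  set Γ := maxDensity g n with hΓ
  set A := growthWithinMode μ F n with hA
  set v := ∫ x, φ x ^ 2 ∂(μ n) with hv
  have hA1 : 1 ≤ A := one_le_growthWithinMode hn hμg hF hFdisj hFcover hFpos
  have hΓ0 : 0 ≤ Γ := maxDensity_nonneg
  have hρ0 : 0 ≤ ρ := sq_nonneg _
  have hv0 : 0 ≤ v := integral_nonneg fun x => sq_nonneg _
  have hD : 0 < 1 - ρ * Γ := by linarith
  have hρΓ : 0 ≤ ρ * Γ := mul_nonneg hρ0 hΓ0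
  -- The fixed point of `b ↦ ρ Γ b + A Γ v`, an upper bound for every stage variance before the
  -- last.
  set B := A * Γ * v / (1 - ρ * Γ) with hB
  have hBeq : B = ρ * Γ * B + A * Γ * v := by
    have := div_mul_cancel₀ (A * Γ * v) hD.ne'
    rw [← hB] at this
    linarith
  have hAB : A * Γ * v ≤ B := by
    have hB0 : 0 ≤ B := by positivity
    have := mul_nonneg hρΓ hB0
    linarith
  have hstage : ∀ d k, k + (d + 1) = n → ∫ x, propagate g K φ k (d + 1) x ^ 2 ∂(μ k) ≤ B := by
    intro d
    induction d with
    -- Here `k + 1 = n`, outside the range of the recursion; the plain `L²` contraction of `K` gives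
    -- `Γ v`, and `1 ≤ A` brings this below `B`.
    | zero =>
      intro k hk
      obtain rfl : n = k + 1 := by omega
      refine (integral_sq_propagate_succ_le hg hμg hgb hK hφ hφ2 hk).trans (le_trans ?_ hAB)
      have h1 := integral_sq_integral_le_of_invariant (hK (k + 1) (by omega) le_rfl) hφ hφ2
      have h2 : Γ * v ≤ A * (Γ * v) := le_mul_of_one_le_left (mul_nonneg hΓ0 hv0) hA1
      calc _ ≤ Γ * v := mul_le_mul_of_nonneg_left h1 hΓ0
        _ ≤ _ := by linarith
    | succ d ih =>
      intro k hk
      refine (integral_sq_propagate_succ_le hg hμg hgb hK hφ hφ2 hk).trans ?_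
      have h1 := integral_sq_integral_propagate_le hg hμg hgb hK hF hFdisj hFcover hFpos hnomix hφ
        hφ2 (d := d + 1) (k := k) (by omega) (by omega)
      have h2 := mul_le_mul_of_nonneg_left (ih (k + 1) (by omega)) hρ0
      calc _ ≤ Γ * (ρ * B + A * v) := mul_le_mul_of_nonneg_left (by linarith) hΓ0
        _ = B := by linear_combination -hBeq
  rw [asymptoticVariance, Finset.sum_range_succ]
  have hlast : stageVariance μ g K φ n n = v := by simp [stageVariance, propagate, hv]
  have hsum : ∑ k ∈ Finset.range n, stageVariance μ g K φ k n ≤ n * B := by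
    refine (Finset.sum_le_card_nsmul _ _ B fun k hk => ?_).trans_eq (by simp)
    have hk' := Finset.mem_range.1 hk
    have h := hstage (n - k - 1) k (by omega)
    rwa [show n - k - 1 + 1 = n - k by omega] at h
  rw [hlast]
  calc _ ≤ n * B + v := by linarith
    _ = _ := by rw [hB]; ring

end Model

/-- Domination by `1 + |φ|^(2 + ε)`. -/
lemma integrable_sq_of_integrable_rpow {ν : Measure E} [IsFiniteMeasure ν] {φ : E → ℝ}
    (hφ : Measurable φ) {ε : ℝ} (hε : 0 < ε)
    (h : Integrable (fun x => |φ x| ^ (2 + ε)) ν) : Integrable (fun x => φ x ^ 2) ν := by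
  refine ((integrable_const (1 : ℝ)).add h).mono' (hφ.pow_const 2).aestronglyMeasurable
    (ae_of_all _ fun x => ?_)
  rw [Real.norm_of_nonneg (sq_nonneg _), ← sq_abs, Pi.add_apply]
  have h0 : 0 ≤ |φ x| ^ (2 + ε) := by positivity
  rcases le_total |φ x| 1 with h1 | h1
  · nlinarith [abs_nonneg (φ x)]
  · have : |φ x| ^ (2 : ℝ) ≤ |φ x| ^ (2 + ε) := Real.rpow_le_rpow_of_exponent_le h1 (by linarith)
    rw [Real.rpow_two] at this
    linarith

end SMC

theorem mainTheorem5 {E : Type*} [MeasurableSpace E] [StandardBorelSpace E]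
    (n : ℕ) (hn : 1 ≤ n)
    -- the interpolating distributions (only the indices `0, …, n` matter)
    (μ : ℕ → Measure E) [∀ k, IsProbabilityMeasure (μ k)]
    -- `g k` is a version of `dμ_{k+1} / dμ_k`, bounded
    (g : ℕ → E → ℝ≥0) (hg : ∀ k, Measurable (g k))
    (hμg : ∀ k < n, μ (k + 1) = (μ k).withDensity fun x => (g k x : ℝ≥0∞))
    (hgb : ∀ k < n, BddAbove (Set.range fun x => (g k x : ℝ)))
    -- `K k` is a Markov kernel leaving `μ k` invariant
    (K : ℕ → Kernel E E) [∀ k, IsMarkovKernel (K k)]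
    (hK : ∀ k, 1 ≤ k → k ≤ n → Kernel.Invariant (K k) (μ k))
    -- the modes: a measurable partition, all modes having positive mass
    (m : ℕ) (F : Fin m → Set E) (hF : ∀ r, MeasurableSet (F r))
    (hFdisj : Pairwise fun r s => Disjoint (F r) (F s)) (hFcover : ⋃ r, F r = Set.univ)
    (hFpos : ∀ k, 1 ≤ k → k ≤ n → ∀ r, 0 < μ k (F r))
    -- no mixing between the modes
    (hnomix : ∀ k, 1 ≤ k → k ≤ n → ∀ r, ∀ x ∈ F r, K k x (F r) = 1)
    (hΓγ : (1 - SMC.localGap μ K F hF n) ^ 2 * SMC.maxDensity g n < 1)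
    -- the test function
    (φ : E → ℝ) (hφ : Measurable φ)
    (hφint : ∃ ε : ℝ, 0 < ε ∧ Integrable (fun x => |φ x| ^ (2 + ε)) (μ n))
    (hφ0 : ∫ x, φ x ∂(μ n) = 0) :
    TendstoInDistribution (fun N : ℕ => SMC.scaledError (μ n) φ N) atTop (id : ℝ → ℝ)
      (fun N : ℕ => SMC.particleLaw (μ 0) g hg K N n)
      (gaussianReal 0 (SMC.asymptoticVariance μ g K φ n).toNNReal) ∧
    SMC.asymptoticVariance μ g K φ n ≤
      (1 + n * SMC.growthWithinMode μ F n * SMC.maxDensity g n /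
        (1 - (1 - SMC.localGap μ K F hF n) ^ 2 * SMC.maxDensity g n)) * Var[φ; μ n] := by

  obtain ⟨ε, hε, hφε⟩ := hφint
  have hφ2 := SMC.integrable_sq_of_integrable_rpow hφ hε hφε
  refine ⟨SMC.tendstoInDistribution_scaledError hg hμg hgb hK hφ hφ2 hφ0, ?_⟩
  rw [variance_of_integral_eq_zero hφ.aemeasurable hφ0]
  exact SMC.asymptoticVariance_le hn hg hμg hgb hK hF hFdisj hFcover hFpos hnomix hΓγ hφ hφ2
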